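/- **Conventions.** For $m\ge 2$, the cycle $C_m$ has vertices $1,\dots,m$ in clockwise order and $m$ edges, one joining $i$ to $i+1$ for each $i$ modulo $m$ (so $C_2$ has two parallel edges). The wheel $W_m$ is $C_m$ together with a vertex $0$, the sink, joined to each vertex of $C_m$ by one edge. A configuration on $W_m$ is a vector $c=(c_1,\dots,c_m)$ of non-negative integers. It is stable if $c_i<\deg(i)=3$ for all $i$. In the Abelian sandpile model (ASM) an unstable vertex topples by sending one grain along each incident edge; in the stochastic sandpile model (SSM) with parameter $p\in(0,1)$ it sends one grain along each incident edge with probability $p$, independently. Grains sent to the sink disappear, and toppling unstable vertices until none is left yields the stabilisation, whose value (ASM), respectively law (SSM), does not depend on the order of topplings. For a probability distribution $\mu$ on $\{1,\dots,m\}$ with $\mu_i>0$ for all $i$, the sandpile Markov chain on stable configurations adds, at each step, one grain at a $\mu$-random vertex and then stabilises. A stable configuration is recurrent if this chain, started from it, visits it infinitely often almost surely. The level of $c$ is $\mathrm{level}(c)=\sum_i c_i+\deg(0)-|E(W_m)|=\sum_i c_i-m$. A $01^*$-chain of $c$ is a set of cyclically consecutive vertices $j,j+1,\dots,j+l$ $(l\ge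 0)$ with $c_j=0$ and $c_{j+1}=\dots=c_{j+l}=1$, and $\mathrm{weight}^{01^*}(c)$ is the number of vertices that belong to a $01^*$-chain. A subgraph of $C_m$ consists of a non-empty set $A$ of vertices and a set of edges of $C_m$ with both ends in $A$. A differed Delannoy path to $(n,n)$ is a path in $\mathbb Z^2$ from $(0,0)$ to $(n,n)$ with steps $R=(1,0)$, $U=(0,1)$, $D=(1,1)$ whose first step is not $D$. **Theorem 4.3.** Let $n\ge 1$ and $1\le k\le n$. Each of the following three sets has cardinality $$\binom{2k}{k}\binom{n+k-1}{n-k}.$$ 1. The set of recurrent configurations $c$ on $W_{2n}$ with $\mathrm{level}(c)=n$ and $\mathrm{weight}^{01^*}(c)=n-k$; this holds both for the ASM and for the SSM, for every $\mu$ and $p$ as above. 2. The set of subgraphs of $C_{2n}$ with $n$ edges and $k$ connected components (for a subgraph with $n$ edges, having $k$ components is equivalent to having $n+k$ vertices). 3. The set of differed Delannoy paths to $(n,n)$ with $k$ steps $R$ (equivalently, with $n-k$ steps $D$). -/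

import Mathlib

open MeasureTheory ProbabilityTheory Filter
open scoped ENNReal

noncomputable section

namespace Sandpile

/-! ### Cycles, wheels, subgraphs -/

section Graphs

/-- The multigraph in which every element of `α` is a vertex, every element `e` of `β` is an edge,
and the unordered pair of ends of the edge `e` is `ends e`. -/
def graphOfEnds {α β : Type*} (ends : β → Sym2 α) : Graph α β where
  vertexSet := Set.univ
  IsLink e x y := s(x, y) = ends e
  isLink_symm _ _ := ⟨fun _ _ h => Sym2.eq_swap.trans h⟩
  eq_or_eq_of_isLink_of_isLink e x y v w h h' := by
    rcases Sym2.eq_iff.1 (h.trans h'.symm) with ⟨h1, _⟩ | ⟨h1, _⟩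
    · exact Or.inl h1
    · exact Or.inr h1
  left_mem_of_isLink _ _ _ _ := Set.mem_univ _

/-- The vertex reached from `i` after `l` clockwise moves around a cycle with `m` vertices. -/
def shift {m : ℕ} (i : Fin m) (l : ℕ) : Fin m := ⟨(i.val + l) % m, Nat.mod_lt _ i.pos⟩

/-- The cycle `C_m`: the vertices are arranged clockwise, and the edge numbered `i` joins the vertex
`i` to the next one. For `m ≥ 3` this is the usual simple cycle; `C_2` has two parallel edges. -/
def cycle (m : ℕ) : Graph (Fin m) (Fin m) := graphOfEnds fun i => s(i, shift i 1)

/-- The wheel `W_m`: the cycle `C_m` (edges `Sum.inr i`) together with the sink `none`, which is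
joined to each vertex of the cycle by one edge (the spoke `Sum.inl i`). -/
def wheel (m : ℕ) : Graph (Option (Fin m)) (Fin m ⊕ Fin m) :=
  graphOfEnds (Sum.elim (fun i => s(none, some i)) (fun i => s(some i, some (shift i 1))))

/-- The number of connected components: vertices modulo the equivalence relation generated by
adjacency. -/
def numComponents {α β : Type*} (H : Graph α β) : ℕ :=
  Nat.card (Quot fun x y : H.vertexSet => H.Adj x y)

/-- Subgraphs of `G`, the vertex set being nonempty (the set of edges is any set of edges of `G`
whose ends all belong to the chosen vertex set). -/
def Sub {α β : Type*} (G : Graph α β) : Set (Graph α β) := {H | H ≤ G ∧ H.vertexSet.Nonempty}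

end Graphs

/-! ### Markov chains -/

section Chains

variable {S : Type*} [MeasurableSpace S]

/-- The law of the trajectory `(X 0, X 1, X 2, …)` of the time-homogeneous Markov chain with
transition kernel `P` started at `X 0 = c`. -/
def pathLaw (P : Kernel S S) [IsMarkovKernel P] (c : S) : Measure (ℕ → S) :=
  Kernel.traj (X := fun _ => S)
    (fun t => P.comap (fun h : (Π _ : Finset.Iic t, S) => h ⟨t, Finset.mem_Iic.2 le_rfl⟩)
      (measurable_pi_apply _)) 0 (fun _ => c)

instance (P : Kernel S S) [IsMarkovKernel P] (c : S) : IsProbabilityMeasure (pathLaw P c) := by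
  unfold pathLaw; infer_instance

/-- A state is recurrent if the chain started there visits it infinitely often almost surely. -/
def IsRecurrent (P : Kernel S S) [IsMarkovKernel P] (c : S) : Prop :=
  ∀ᵐ ω ∂(pathLaw P c), ∃ᶠ t in atTop, ω t = c

end Chains

/-! ### Configurations and topplings -/

section Model

variable {V E : Type*} [Fintype V] [LinearOrder V] [Fintype E]

/-- Configurations on a graph with vertex set `Option V` and sink `none`. -/
abbrev Config (V : Type*) := V → ℕ

open Classical in
/-- The edges incident with a vertex. -/
def edgesAt (G : Graph (Option V) E) (x : Option V) : Finset E := Finset.univ.filter (G.Inc · x)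

/-- The degree of a vertex (of a graph without loops). -/
def deg (G : Graph (Option V) E) (x : Option V) : ℕ := (edgesAt G x).card

/-- The non-sink vertices that are unstable in the configuration `c`. -/
def unstable (G : Graph (Option V) E) (c : Config V) : Finset V :=
  Finset.univ.filter fun i => deg G (some i) ≤ c i

/-- Stable configurations: no vertex is unstable. -/
def Stable (G : Graph (Option V) E) : Set (Config V) := {c | ∀ i, c i < deg G (some i)}

open Classical in
/-- The vertex `i` sends one grain along each of the edges in `A`, a set of edges incident with `i`;
grains sent to the sink disappear. -/
def send (G : Graph (Option V) E) (i : V) (A : Finset E) (c : Config V) : Config V := fun j =>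
  if j = i then c i - A.card else c j + (A.filter (G.Inc · (some j))).card

/-- The level of a configuration: `∑ c_i + deg(sink) - |E|`. -/
def level (G : Graph (Option V) E) (c : Config V) : ℤ :=
  (∑ i, (c i : ℤ)) + deg G none - (G.edgeSet.ncard : ℤ)

/-! ### The Abelian sandpile model -/

/-- One step of the Abelian stabilisation: the first unstable vertex (if any) topples, sending one
grain along each incident edge. The final result does not depend on the order of topplings. -/
def topple (G : Graph (Option V) E) (c : Config V) : Config V :=
  if h : (unstable G c).Nonempty then
    send G ((unstable G c).min' h) (edgesAt G (some ((unstable G c).min' h))) c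
  else c

/-- The stabilisation in the Abelian model: topple until the configuration is stable. -/
def stabilise (G : Graph (Option V) E) (c : Config V) : Config V :=
  (topple G)^[sInf {t | (topple G)^[t] c ∈ Stable G}] c

/-- The Abelian sandpile Markov chain: put a grain on a `μ`-random vertex, then stabilise. -/
def asmKernel (G : Graph (Option V) E) (μ : PMF V) : Kernel (Config V) (Config V) :=
  Kernel.ofFunOfCountable fun c => (μ.map fun i => stabilise G (c + Pi.single i 1)).toMeasure

instance (G : Graph (Option V) E) (μ : PMF V) : IsMarkovKernel (asmKernel G μ) :=
  ⟨fun _ => PMF.toMeasure.isProbabilityMeasure _⟩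

/-- The recurrent configurations of the Abelian sandpile model. -/
def ASMRec (G : Graph (Option V) E) (μ : PMF V) : Set (Config V) :=
  {c | c ∈ Stable G ∧ IsRecurrent (asmKernel G μ) c}

/-! ### The stochastic sandpile model -/

open Classical in
/-- The random subset of `A` which contains each element of `A` with probability `p`,
independently. -/
def randomSubset (p : unitInterval) (A : Finset E) : PMF (Finset E) :=
  PMF.ofFinset
    (fun B => if B ⊆ A then
        ENNReal.ofReal p ^ B.card * ENNReal.ofReal (1 - p) ^ (A.card - B.card)
      else 0)
    A.powerset
    (by
      rw [Finset.sum_congr rfl fun B hB => if_pos (Finset.mem_powerset.1 hB),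
        Finset.sum_pow_mul_eq_add_pow, ← ENNReal.ofReal_add p.2.1 (sub_nonneg.2 p.2.2)]
      simp)
    (fun B hB => if_neg fun h => hB (Finset.mem_powerset.2 h))

/-- One step of the stochastic stabilisation: the first unstable vertex (if any) topples, sending a
grain along each incident edge with probability `p`, independently. The law of the final result does
not depend on the order of topplings. -/
def randomTopple (G : Graph (Option V) E) (p : unitInterval) (c : Config V) : PMF (Config V) :=
  if h : (unstable G c).Nonempty then
    (randomSubset p (edgesAt G (some ((unstable G c).min' h)))).map fun A =>
      send G ((unstable G c).min' h) A c
  else PMF.pure c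

/-- The Markov chain of successive random topplings. -/
def toppleKernel (G : Graph (Option V) E) (p : unitInterval) : Kernel (Config V) (Config V) :=
  Kernel.ofFunOfCountable fun c => (randomTopple G p c).toMeasure

instance (G : Graph (Option V) E) (p : unitInterval) : IsMarkovKernel (toppleKernel G p) :=
  ⟨fun _ => PMF.toMeasure.isProbabilityMeasure _⟩

/-- The first stable configuration along a trajectory of topplings (and the initial configuration
on the null event where there is none). -/
def firstStable (G : Graph (Option V) E) (ω : ℕ → Config V) : Config V :=
  ω (sInf {t | ω t ∈ Stable G})

theorem measurable_firstStable (G : Graph (Option V) E) : Measurable (firstStable G) := by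
  have hN : Measurable fun ω : ℕ → Config V => sInf {t | ω t ∈ Stable G} := by
    have hs (t : ℕ) : MeasurableSet {ω : ℕ → Config V | ω t ∈ Stable G} :=
      measurable_pi_apply t (Set.to_countable (Stable G)).measurableSet
    refine measurable_to_countable' fun n => ?_
    have hset : (fun ω : ℕ → Config V => sInf {t | ω t ∈ Stable G}) ⁻¹' {n} =
        ({ω | ω n ∈ Stable G} ∩ ⋂ t ∈ Finset.range n, {ω | ω t ∈ Stable G}ᶜ) ∪
          {ω | n = 0 ∧ ∀ t, ω t ∉ Stable G} := by
      ext ω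
      simp only [Set.mem_preimage, Set.mem_singleton_iff, Set.mem_union, Set.mem_inter_iff,
        Set.mem_ofPred_eq, Set.mem_iInter, Finset.mem_range, Set.mem_compl_iff]
      constructor
      · rintro rfl
        by_cases h : {t | ω t ∈ Stable G}.Nonempty
        · exact Or.inl ⟨Nat.sInf_mem h, fun t ht => Nat.notMem_of_lt_sInf ht⟩
        · rw [Set.not_nonempty_iff_eq_empty] at h
          refine Or.inr ⟨by rw [h, Nat.sInf_empty], fun t ht => ?_⟩
          have : t ∈ {t | ω t ∈ Stable G} := ht
          rw [h] at this
          exact this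
      · rintro (⟨h1, h2⟩ | ⟨rfl, h⟩)
        · refine le_antisymm (Nat.sInf_le h1) (le_of_not_gt fun hlt => h2 _ hlt ?_)
          exact Nat.sInf_mem (s := {t | ω t ∈ Stable G}) ⟨n, h1⟩
        · have : {t | ω t ∈ Stable G} = ∅ := Set.eq_empty_iff_forall_notMem.2 h
          rw [this, Nat.sInf_empty]
    rw [hset]
    refine ((hs n).inter (Finset.measurableSet_biInter _ fun t _ => (hs t).compl)).union ?_
    by_cases hn : n = 0
    · simp only [hn, true_and, Set.ofPred_forall]
      exact MeasurableSet.iInter fun t => (hs t).compl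
    · simp [hn]
  have huncurry : Measurable fun q : ℕ × (ℕ → Config V) => q.2 q.1 :=
    measurable_from_prod_countable_right fun n => measurable_pi_apply n
  exact huncurry.comp (hN.prodMk measurable_id)

/-- The law of the stabilisation of a configuration in the stochastic model. -/
def stabKernel (G : Graph (Option V) E) (p : unitInterval) : Kernel (Config V) (Config V) :=
  Kernel.ofFunOfCountable fun c => (pathLaw (toppleKernel G p) c).map (firstStable G)

instance (G : Graph (Option V) E) (p : unitInterval) : IsMarkovKernel (stabKernel G p) :=
  ⟨fun _ => Measure.isProbabilityMeasure_map (measurable_firstStable G).aemeasurable⟩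

/-- The stochastic sandpile Markov chain: put a grain on a `μ`-random vertex, then stabilise. -/
def ssmKernel (G : Graph (Option V) E) (μ : PMF V) (p : unitInterval) :
    Kernel (Config V) (Config V) :=
  Kernel.ofFunOfCountable fun c =>
    (μ.map fun i => c + Pi.single i 1).toMeasure.bind (stabKernel G p)

instance (G : Graph (Option V) E) (μ : PMF V) (p : unitInterval) :
    IsMarkovKernel (ssmKernel G μ p) :=
  ⟨fun c => by
    change IsProbabilityMeasure
      ((μ.map fun i => c + Pi.single i 1).toMeasure.bind (stabKernel G p))
    infer_instance⟩

/-- The recurrent configurations of the stochastic sandpile model. -/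
def SSMRec (G : Graph (Option V) E) (μ : PMF V) (p : unitInterval) : Set (Config V) :=
  {c | c ∈ Stable G ∧ IsRecurrent (ssmKernel G μ p) c}

end Model

/-! ### Chains `01*` -/

/-- A set of consecutive vertices `j, j + 1, …, j + k` (clockwise) with `c j = 0` and `c = 1` at all
the others. -/
def IsChain01 {m : ℕ} (c : Config (Fin m)) (A : Finset (Fin m)) : Prop :=
  ∃ (j : Fin m) (k : ℕ), c j = 0 ∧ (∀ l, 1 ≤ l → l ≤ k → c (shift j l) = 1) ∧
    A = (Finset.range (k + 1)).image (shift j)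

/-- The number of vertices that belong to a `01*`-chain. -/
def weight01 {m : ℕ} (c : Config (Fin m)) : ℕ := {i | ∃ A, IsChain01 c A ∧ i ∈ A}.ncard

/-! ### Delannoy paths -/

/-- The steps of Delannoy paths. -/
inductive Step
  | R
  | U
  | D
  deriving DecidableEq

/-- The displacement of a step. -/
def Step.vec : Step → ℤ × ℤ
  | R => (1, 0)
  | U => (0, 1)
  | D => (1, 1)

/-- Differed Delannoy paths to `(n, n)`: paths from `(0, 0)` (given by their sequences of steps)
whose first step is not `D`. -/
def DiffDel (n : ℕ) : Set (List Step) :=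
  {w | (w.map Step.vec).sum = ((n : ℤ), (n : ℤ)) ∧ w.head? ≠ some Step.D}

end Sandpile

end

/-! All three families are encoded by words in `R`, `U`, `D`, once recurrence has been made
combinatorial. Call a configuration edge-bounded if every vertex set `A` carries at least as many
grains as the cycle has edges inside `A` (`EdgeBounded`). Any toppling, full or partial, preserves
this (`EdgeBounded.send`), and the all-2 configuration has it. Every stable configuration can reach
all-2, so a recurrent one is reachable from all-2 and hence edge-bounded. Conversely, with more than
`m` grains, an edge-bounded stable `c` passes the burning test: `c + 1` topples back to `c`, so `2 +
c` stabilises to `c`, and `c` is reachable from all-2. The random model can imitate the abelian one,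
so above level 0 both models have the same recurrent configurations (`isRecurrent_iff_edgeBounded`).
Such configurations correspond to subgraphs of the cycle: the vertices in `01*`-chains are the
missing ones, and an edge joins `i` to the next vertex when `i` is present and the next vertex
carries 2. The number of grains is `m` plus the number of edges (`ncard_configs_eq`). A subgraph
with `n < m` edges is a union of arcs, so components plus edges equal vertices. Reading a subgraph
around the cycle (`D` missing, `U` joined to the next vertex, `R` end of a component) gives the
words with no cyclic factor `UD`. Linear words avoiding `UD` are counted by cutting at the letters
`R`; subtracting those that begin with `D` and end with `U` leaves the cyclic ones, and
`choose_identity` simplifies the difference. Delannoy paths are counted by deleting their first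
step, `R` or `U`. -/

noncomputable section

namespace Sandpile

/-! ### Recurrence and reachability for countable Markov chains -/

section MarkovChains

variable {S : Type*} [MeasurableSpace S]

/-- `y` can be reached from `x` in one step of the chain with positive probability. -/
def PosStep (P : Kernel S S) (x y : S) : Prop := P x {y} ≠ 0

/-- `y` can be reached from `x` with positive probability. -/
abbrev Reach (P : Kernel S S) : S → S → Prop := Relation.ReflTransGen (PosStep P)

theorem measurableSet_eval_eq {ι : Type*} [MeasurableSingletonClass S] (t : ι) (x : S) :
    MeasurableSet {ω : ι → S | ω t = x} := by
  have h : MeasurableSet ((fun ω : ι → S => ω t) ⁻¹' {x}) :=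
    measurable_pi_apply t (measurableSet_singleton x)
  exact h

variable [MeasurableSingletonClass S] (P : Kernel S S) [IsMarkovKernel P] (c : S)

theorem pathLaw_start : ∀ᵐ ω ∂(pathLaw P c), ω 0 = c := by
  have h := Kernel.traj_map_frestrictLe_apply (X := fun _ => S)
    (κ := fun t => P.comap (fun h : (Π _ : Finset.Iic t, S) => h ⟨t, Finset.mem_Iic.2 le_rfl⟩)
      (measurable_pi_apply _)) 0 0 (fun _ => c)
  rw [Kernel.partialTraj_self, Kernel.id_apply] at h
  have h2 : ∀ᵐ x ∂((pathLaw P c).map (Preorder.frestrictLe (π := fun _ => S) 0)),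
      x ⟨0, Finset.mem_Iic.2 le_rfl⟩ = c := by
    unfold pathLaw
    rw [h, ae_dirac_iff]
    exact measurableSet_eval_eq _ c
  exact ae_of_ae_map (Preorder.measurable_frestrictLe 0).aemeasurable h2

/-- The one-step Markov property: the joint law of the past up to `t` and of the next state is the
composition product of the law of the past with `P` at the current state. -/
theorem pathLaw_step (t : ℕ) (x y : S) :
    pathLaw P c {ω | ω t = x ∧ ω (t + 1) = y} = pathLaw P c {ω | ω t = x} * P x {y} := by
  have h := Kernel.partialTraj_compProd_eq_map_traj (X := fun _ => S)
    (κ := fun t => P.comap (fun h : (Π _ : Finset.Iic t, S) => h ⟨t, Finset.mem_Iic.2 le_rfl⟩)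
      (measurable_pi_apply _)) (Nat.zero_le t) (x₀ := fun _ => c)
  have hm := Kernel.traj_map_frestrictLe_apply (X := fun _ => S)
    (κ := fun t => P.comap (fun h : (Π _ : Finset.Iic t, S) => h ⟨t, Finset.mem_Iic.2 le_rfl⟩)
      (measurable_pi_apply _)) 0 t (fun _ => c)
  have hA : MeasurableSet {h : (Π _ : Finset.Iic t, S) | h ⟨t, Finset.mem_Iic.2 le_rfl⟩ = x} :=
    measurableSet_eval_eq _ x
  have h1 := congrArg (fun ν => ν ({h | h ⟨t, Finset.mem_Iic.2 le_rfl⟩ = x} ×ˢ {y})) h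
  beta_reduce at h1
  rw [Measure.compProd_apply_prod hA (measurableSet_singleton y),
    Measure.map_apply (by fun_prop) (hA.prod (measurableSet_singleton y))] at h1
  rw [← hm] at h1
  have h3 : ∀ z ∈ {h : (Π _ : Finset.Iic t, S) | h ⟨t, Finset.mem_Iic.2 le_rfl⟩ = x},
      (P.comap (fun h : (Π _ : Finset.Iic t, S) => h ⟨t, Finset.mem_Iic.2 le_rfl⟩)
      (measurable_pi_apply _)) z {y} = P x {y} := by
    intro z hz
    rw [Kernel.comap_apply]
    rw [show z ⟨t, Finset.mem_Iic.2 le_rfl⟩ = x from hz]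
  rw [setLIntegral_congr_fun hA h3, setLIntegral_const,
    Measure.map_apply (Preorder.measurable_frestrictLe t) hA, mul_comm] at h1
  exact h1.symm

theorem ae_posStep [Countable S] : ∀ᵐ ω ∂(pathLaw P c), ∀ t, PosStep P (ω t) (ω (t + 1)) := by
  rw [ae_all_iff]
  intro t
  have h : ∀ x y, ¬ PosStep P x y → ∀ᵐ ω ∂(pathLaw P c), ¬ (ω t = x ∧ ω (t + 1) = y) := by
    intro x y hxy
    rw [ae_iff]
    simp only [not_not]
    rw [pathLaw_step, not_not.1 hxy, mul_zero]
  have h2 : ∀ᵐ ω ∂(pathLaw P c), ∀ x y, ¬ PosStep P x y → ¬ (ω t = x ∧ ω (t + 1) = y) := by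
    rw [ae_all_iff]; intro x
    rw [ae_all_iff]; intro y
    by_cases hxy : PosStep P x y
    · exact .of_forall fun _ h => absurd hxy h
    · filter_upwards [h x y hxy] with ω hω _ using hω
  filter_upwards [h2] with ω hω
  by_contra hc
  exact hω _ _ hc ⟨rfl, rfl⟩

theorem ae_reach [Countable S] : ∀ᵐ ω ∂(pathLaw P c), ω 0 = c ∧ ∀ s t, s ≤ t → Reach P (ω s) (ω t) := by
  filter_upwards [pathLaw_start P c, ae_posStep P c] with ω h0 hω
  refine ⟨h0, fun s t hst => ?_⟩
  induction t, hst using Nat.le_induction with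
  | base => exact .refl
  | succ t _ ih => exact ih.tail (hω t)

theorem exists_pos_of_reach {d : S} (h : Reach P c d) :
    ∃ t, pathLaw P c {ω | ω t = d} ≠ 0 := by
  induction h with
  | refl =>
    refine ⟨0, ?_⟩
    rw [(prob_compl_eq_zero_iff (measurableSet_eval_eq 0 c)).1 (ae_iff.1 (pathLaw_start P c))]
    exact one_ne_zero
  | @tail x y _ hxy ih =>
    obtain ⟨t, ht⟩ := ih
    refine ⟨t + 1, fun h0 => mul_ne_zero ht hxy ?_⟩
    rw [← pathLaw_step]
    exact measure_mono_null (fun ω hω => hω.2) h0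

/-- Some time `t` has `ω t = d` with positive probability; almost surely `c` is visited after `t`,
and almost every trajectory moves only along positive steps. -/
theorem reach_of_isRecurrent [Countable S] {d : S} (hc : IsRecurrent P c) (h : Reach P c d) : Reach P d c := by
  obtain ⟨t, ht⟩ := exists_pos_of_reach P c h
  by_contra hdc
  refine ht (measure_mono_null (t := {ω | ¬ ((ω 0 = c ∧ ∀ s t, s ≤ t → Reach P (ω s) (ω t)) ∧
    ∃ᶠ t in atTop, ω t = c)}) ?_ (ae_iff.1 ((ae_reach P c).and hc)))
  rintro ω hω ⟨⟨_, h1⟩, h2⟩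
  obtain ⟨s, hs, hsc⟩ := (frequently_atTop.1 h2) t
  have := h1 t s hs
  rw [hsc, show ω t = d from hω] at this
  exact hdc this

/-- Lévy's conditional Borel–Cantelli lemma: given the past, the next state is `y` with probability
at least a fixed `ε > 0` at each visit to `x`, so infinitely many visits to `x` make the conditional
probabilities sum to infinity. -/
theorem ae_frequently_of_posStep {x y : S} (hxy : PosStep P x y) :
    ∀ᵐ ω ∂(pathLaw P c), (∃ᶠ t in atTop, ω t = x) → ∃ᶠ t in atTop, ω t = y := by
  have hm : ∀ (z : S) (t : ℕ), MeasurableSet {ω : ℕ → S | ω t = z} := fun z t =>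
    measurableSet_eval_eq t z
  have hs : ∀ n, MeasurableSet[Filtration.piLE (X := fun _ => S) n] {ω : ℕ → S | ω n = y} := by
    intro n
    refine ⟨{h | h ⟨n, Set.mem_Iic.2 le_rfl⟩ = y},
      measurableSet_eval_eq _ y, rfl⟩
  have hL := ae_mem_limsup_atTop_iff (pathLaw P c) hs
  have hC : ∀ k, ∀ᵐ ω ∂(pathLaw P c),
      ((pathLaw P c)[({ω : ℕ → S | ω (k + 1) = y}).indicator (1 : (ℕ → S) → ℝ) |
        Filtration.piLE (X := fun _ => S) k]) ω = (P (ω k)).real {y} := by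
    intro k
    have := Kernel.condExp_traj (X := fun _ => S)
      (κ := fun t => P.comap (fun h : (Π _ : Finset.Iic t, S) => h ⟨t, Finset.mem_Iic.2 le_rfl⟩)
      (measurable_pi_apply _)) (Nat.zero_le k) (x₀ := fun _ => c)
      (f := ({ω : ℕ → S | ω (k + 1) = y}).indicator (1 : (ℕ → S) → ℝ))
      ((integrable_const (1 : ℝ)).indicator (hm y (k + 1)))
    filter_upwards [this] with ω hω
    refine hω.trans ?_
    rw [integral_indicator_one (hm y (k + 1)), measureReal_def, measureReal_def]
    congr 1
    have h2 := congrArg (fun κ => κ (Preorder.frestrictLe (π := fun _ => S) k ω) {y})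
      (Kernel.map_traj_succ_self (X := fun _ => S)
      (κ := fun t => P.comap (fun h : (Π _ : Finset.Iic t, S) => h ⟨t, Finset.mem_Iic.2 le_rfl⟩)
      (measurable_pi_apply _)) (a := k))
    beta_reduce at h2
    rw [Kernel.map_apply' _ (measurable_pi_apply _) _ (measurableSet_singleton y),
      Kernel.comap_apply] at h2
    exact h2
  filter_upwards [hL, ae_all_iff.2 hC] with ω h1 h2 hx
  have : ω ∈ limsup (fun n => {ω : ℕ → S | ω n = y}) atTop := by
    rw [h1]
    simp only [h2]
    set ε := (P x).real {y} with hε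
    have hεpos : 0 < ε := ENNReal.toReal_pos hxy (measure_ne_top _ _)
    refine tendsto_atTop_atTop_of_monotone ?_ ?_
    · exact fun a b hab => Finset.sum_le_sum_of_subset_of_nonneg
        (Finset.range_mono hab) fun _ _ _ => measureReal_nonneg
    -- Each further visit to `x` adds `ε` to the partial sums.
    · have key : ∀ N : ℕ, ∃ a, N * ε ≤ ∑ k ∈ Finset.range a, (P (ω k)).real {y} := by
        intro N
        induction N with
        | zero => exact ⟨0, by simp⟩
        | succ N ih =>
          obtain ⟨a, ha⟩ := ih
          obtain ⟨b, hab, hb⟩ := (frequently_atTop.1 hx) a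
          refine ⟨b + 1, ?_⟩
          rw [Finset.sum_range_succ, hb, Nat.cast_succ, add_mul, one_mul]
          have : ∑ k ∈ Finset.range a, (P (ω k)).real {y} ≤
              ∑ k ∈ Finset.range b, (P (ω k)).real {y} :=
            Finset.sum_le_sum_of_subset_of_nonneg (Finset.range_mono hab)
              fun _ _ _ => measureReal_nonneg
          linarith
      intro M
      obtain ⟨N, hN⟩ := exists_nat_gt (M / ε)
      obtain ⟨a, ha⟩ := key N
      exact ⟨a, le_trans ((div_lt_iff₀ hεpos).1 hN).le ha⟩
  rw [mem_limsup_iff_frequently_mem] at this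
  exact this

/-- By pigeonhole on the finite reachable set, some state recurs infinitely often; recurrence then
propagates along a positive path into `T`. -/
theorem ae_frequently_mem [Countable S] {T : Set S} (hfin : {y | Reach P c y}.Finite)
    (hT : ∀ y, Reach P c y → ∃ z ∈ T, Reach P y z) :
    ∀ᵐ ω ∂(pathLaw P c), ∃ᶠ t in atTop, ω t ∈ T := by
  have h : ∀ᵐ ω ∂(pathLaw P c), ∀ x y, PosStep P x y →
      (∃ᶠ t in atTop, ω t = x) → ∃ᶠ t in atTop, ω t = y := by
    rw [ae_all_iff]; intro x
    rw [ae_all_iff]; intro y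
    by_cases hxy : PosStep P x y
    · filter_upwards [ae_frequently_of_posStep P c hxy] with ω hω _ using hω
    · exact .of_forall fun _ h => absurd h hxy
  filter_upwards [ae_reach P c, h] with ω h1 h2
  have h0 : ∀ t, Reach P c (ω t) := fun t => h1.1 ▸ h1.2 0 t (Nat.zero_le t)
  obtain ⟨y, hy, hyf⟩ : ∃ y ∈ {y | Reach P c y}, ∃ᶠ t in atTop, ω t = y := by
    by_contra! hc
    have := (eventually_all_finite hfin).2 hc
    obtain ⟨t, ht⟩ := this.exists
    exact ht _ (h0 t) rfl
  obtain ⟨z, hz, hyz⟩ := hT y hy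
  have : ∃ᶠ t in atTop, ω t = z := by
    clear hz
    induction hyz with
    | refl => exact hyf
    | tail _ hab ih => exact h2 _ _ hab ih
  exact this.mono fun t ht => ht ▸ hz

end MarkovChains

/-! ### Possible transitions of the two sandpile chains -/

section Steps

variable {V E : Type*} [Fintype V] [Fintype E] (G : Graph (Option V) E)

theorem unstable_nonempty_iff {c : Config V} : (unstable G c).Nonempty ↔ c ∉ Stable G := by
  simp only [Finset.Nonempty, unstable, Finset.mem_filter, Finset.mem_univ, true_and, Stable,
    Set.mem_ofPred_eq, not_forall, not_lt]

variable [LinearOrder V]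

theorem posStep_asmKernel_iff {μ : PMF V} (hμ : ∀ i, 0 < μ i) {c d : Config V} :
    PosStep (asmKernel G μ) c d ↔ ∃ i, stabilise G (c + Pi.single i 1) = d := by
  change (μ.map fun i => stabilise G (c + Pi.single i 1)).toMeasure {d} ≠ 0 ↔ _
  rw [PMF.toMeasure_apply_singleton _ _ (measurableSet_singleton d), ← PMF.mem_support_iff,
    PMF.mem_support_map_iff]
  exact ⟨fun ⟨i, _, h⟩ => ⟨i, h⟩, fun ⟨i, h⟩ => ⟨i, (PMF.mem_support_iff _ _).2 (hμ i).ne', h⟩⟩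

theorem mem_support_randomSubset_iff {p : unitInterval} (hp0 : 0 < p) (hp1 : p < 1)
    {F : Type*} {A B : Finset F} : B ∈ (randomSubset p A).support ↔ B ⊆ A := by
  rw [PMF.mem_support_iff]
  simp only [randomSubset, PMF.ofFinset_apply]
  split_ifs with h
  · simp only [h, iff_true]
    refine mul_ne_zero (pow_ne_zero _ ?_) (pow_ne_zero _ ?_)
    · exact (ENNReal.ofReal_pos.2 hp0).ne'
    · exact (ENNReal.ofReal_pos.2 (sub_pos.2 hp1)).ne'
  · simp [h]

theorem posStep_toppleKernel {p : unitInterval} (hp0 : 0 < p) (hp1 : p < 1) {c d : Config V}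
    (h : PosStep (toppleKernel G p) c d) : (c ∈ Stable G ∧ d = c) ∨
      ∃ i ∈ unstable G c, ∃ A ⊆ edgesAt G (some i), d = send G i A c := by
  change (randomTopple G p c).toMeasure {d} ≠ 0 at h
  rw [PMF.toMeasure_apply_singleton _ _ (measurableSet_singleton d), ← PMF.mem_support_iff] at h
  unfold randomTopple at h
  split_ifs at h with hc
  · rw [PMF.mem_support_map_iff] at h
    obtain ⟨A, hA, rfl⟩ := h
    exact .inr ⟨_, Finset.min'_mem _ hc, A, (mem_support_randomSubset_iff hp0 hp1).1 hA, rfl⟩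
  · rw [PMF.mem_support_pure_iff] at h
    rw [unstable_nonempty_iff, not_not] at hc
    exact .inl ⟨hc, h⟩

/-- Choosing every incident edge has positive probability, so the random model can imitate the
abelian one. -/
theorem posStep_toppleKernel_topple {p : unitInterval} (hp0 : 0 < p) (hp1 : p < 1)
    (c : Config V) : PosStep (toppleKernel G p) c (topple G c) := by
  change (randomTopple G p c).toMeasure {topple G c} ≠ 0
  rw [PMF.toMeasure_apply_singleton _ _ (measurableSet_singleton _), ← PMF.mem_support_iff]
  unfold randomTopple topple
  split_ifs with hc
  · rw [PMF.mem_support_map_iff]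
    exact ⟨_, (mem_support_randomSubset_iff hp0 hp1).2 subset_rfl, rfl⟩
  · simp

theorem reach_toppleKernel_iterate {p : unitInterval} (hp0 : 0 < p) (hp1 : p < 1)
    (c : Config V) (t : ℕ) : Reach (toppleKernel G p) c ((topple G)^[t] c) := by
  induction t with
  | zero => exact .refl
  | succ t ih =>
    rw [Function.iterate_succ_apply']
    exact ih.tail (posStep_toppleKernel_topple G hp0 hp1 _)

theorem eq_of_reach_toppleKernel {p : unitInterval} (hp0 : 0 < p) (hp1 : p < 1)
    {c d : Config V} (hc : c ∈ Stable G) (h : Reach (toppleKernel G p) c d) : d = c := by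
  induction h with
  | refl => rfl
  | tail _ h ih =>
    subst ih
    rcases posStep_toppleKernel G hp0 hp1 h with h | ⟨i, hi, _⟩
    · exact h.2
    · exact absurd hc ((unstable_nonempty_iff G).1 ⟨i, hi⟩)

theorem stabilise_mem_stable
    (hterm : ∀ c : Config V, ∃ t, (topple G)^[t] c ∈ Stable G) (c : Config V) : stabilise G c ∈ Stable G :=
  Nat.sInf_mem (s := {t | (topple G)^[t] c ∈ Stable G}) (hterm c)

/-- Random topplings almost surely reach a stable state, and stable states are absorbing; hence the
possible outcomes are exactly the reachable stable states. -/
theorem posStep_stabKernel_iff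
    (hterm : ∀ c : Config V, ∃ t, (topple G)^[t] c ∈ Stable G)
    {p : unitInterval} (hp0 : 0 < p) (hp1 : p < 1) {c d : Config V}
    (hfin : {y | Reach (toppleKernel G p) c y}.Finite) :
    PosStep (stabKernel G p) c d ↔ d ∈ Stable G ∧ Reach (toppleKernel G p) c d := by
  have hval : stabKernel G p c {d} = pathLaw (toppleKernel G p) c {ω | firstStable G ω = d} :=
    Measure.map_apply (measurable_firstStable G) (measurableSet_singleton d)
  rw [PosStep, hval]
  constructor
  · intro h
    have h1 := ae_frequently_mem (toppleKernel G p) c (T := Stable G) hfin fun y _ => by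
      obtain ⟨t, ht⟩ := hterm y
      exact ⟨_, ht, reach_toppleKernel_iterate G hp0 hp1 y t⟩
    by_contra hc
    refine h (measure_mono_null ?_ (ae_iff.1 (h1.and (ae_reach (toppleKernel G p) c))))
    rintro ω hω ⟨h2, h3, h4⟩
    -- The default `sInf ∅ = 0` plays no role: the set of stable times is almost surely nonempty.
    have h5 : firstStable G ω ∈ Stable G := Nat.sInf_mem (s := {t | ω t ∈ Stable G}) h2.exists
    have h6 : Reach (toppleKernel G p) (ω 0) (firstStable G ω) := h4 0 _ (Nat.zero_le _)
    rw [show firstStable G ω = d from hω] at h5 h6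
    rw [h3] at h6
    exact hc ⟨h5, h6⟩
  · rintro ⟨hd, h⟩ h0
    obtain ⟨t, ht⟩ := exists_pos_of_reach _ c h
    refine ht ?_
    have h1 : ∀ᵐ ω ∂(pathLaw (toppleKernel G p) c), firstStable G ω ≠ d := by
      rw [ae_iff]; simpa using h0
    refine measure_mono_null ?_ (ae_iff.1 (h1.and (ae_reach (toppleKernel G p) c)))
    rintro ω hω ⟨h2, h3, h4⟩
    replace hω : ω t = d := hω
    have hmem : t ∈ {t | ω t ∈ Stable G} := by
      change ω t ∈ Stable G
      rw [hω]; exact hd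
    have h5 : firstStable G ω ∈ Stable G := Nat.sInf_mem (s := {t | ω t ∈ Stable G}) ⟨t, hmem⟩
    -- The first stable time is at most `t`, and nothing moves after it.
    have h6 : Reach (toppleKernel G p) (firstStable G ω) (ω t) := h4 _ _ (Nat.sInf_le hmem)
    exact h2 ((eq_of_reach_toppleKernel G hp0 hp1 h5 h6).symm.trans hω)

theorem posStep_ssmKernel_iff
    (hterm : ∀ c : Config V, ∃ t, (topple G)^[t] c ∈ Stable G)
    {μ : PMF V} (hμ : ∀ i, 0 < μ i) {p : unitInterval} (hp0 : 0 < p)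
    (hp1 : p < 1) {c d : Config V} (hfin : ∀ c, {y | Reach (toppleKernel G p) c y}.Finite) :
    PosStep (ssmKernel G μ p) c d ↔
      d ∈ Stable G ∧ ∃ i, Reach (toppleKernel G p) (c + Pi.single i 1) d := by
  have hval : ssmKernel G μ p c {d} = ∑' x, stabKernel G p x {d} *
      (μ.map fun i => c + Pi.single i 1) x := by
    change ((μ.map fun i => c + Pi.single i 1).toMeasure.bind (stabKernel G p)) {d} = _
    rw [Measure.bind_apply (measurableSet_singleton d) (Kernel.aemeasurable _),
      lintegral_countable']
    simp only [PMF.toMeasure_apply_singleton _ _ (measurableSet_singleton _)]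
  rw [PosStep, hval, ne_eq, ENNReal.tsum_eq_zero]
  simp only [mul_eq_zero, not_forall, not_or]
  constructor
  · rintro ⟨x, hx, hx'⟩
    rw [← ne_eq, ← PMF.mem_support_iff, PMF.mem_support_map_iff] at hx'
    obtain ⟨i, -, rfl⟩ := hx'
    obtain ⟨h1, h2⟩ := (posStep_stabKernel_iff G hterm hp0 hp1 (hfin _)).1 hx
    exact ⟨h1, i, h2⟩
  · rintro ⟨hd, i, h⟩
    refine ⟨c + Pi.single i 1, (posStep_stabKernel_iff G hterm hp0 hp1 (hfin _)).2 ⟨hd, h⟩, ?_⟩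
    rw [← ne_eq, ← PMF.mem_support_iff, PMF.mem_support_map_iff]
    exact ⟨i, (PMF.mem_support_iff _ _).2 (hμ i).ne', rfl⟩

end Steps

/-! ### Rotation of the cycle -/

section Rotation

/-- The clockwise rotation of the cycle by one vertex. -/
def rot (m : ℕ) : Fin m ≃ Fin m where
  toFun i := shift i 1
  invFun i := shift i (m - 1)
  left_inv i := by
    have := i.isLt
    ext
    simp only [shift, Nat.mod_add_mod]
    rw [show i.val + 1 + (m - 1) = i.val + m by omega, Nat.add_mod_right, Nat.mod_eq_of_lt this]
  right_inv i := by
    have := i.isLt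
    ext
    simp only [shift, Nat.mod_add_mod]
    rw [show i.val + (m - 1) + 1 = i.val + m by omega, Nat.add_mod_right, Nat.mod_eq_of_lt this]

variable {m : ℕ}

theorem shift_one (i : Fin m) : shift i 1 = rot m i := rfl

theorem shift_zero (i : Fin m) : shift i 0 = i := by
  ext; simp [shift, Nat.mod_eq_of_lt i.isLt]

theorem shift_succ (i : Fin m) (l : ℕ) : shift i (l + 1) = rot m (shift i l) := by
  ext; simp [shift, rot, Nat.add_assoc]

theorem shift_rot (i : Fin m) (l : ℕ) : shift (rot m i) l = shift i (l + 1) := by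
  ext; simp [shift, rot, Nat.add_assoc, Nat.add_comm 1 l]

theorem exists_shift_eq (i j : Fin m) : ∃ l < m, shift i l = j := by
  have hi := i.isLt
  have hj := j.isLt
  refine ⟨(j.val + (m - i.val)) % m, Nat.mod_lt _ i.pos, ?_⟩
  ext
  simp only [shift, Nat.add_mod_mod]
  rw [show i.val + (j.val + (m - i.val)) = j.val + m by omega, Nat.add_mod_right,
    Nat.mod_eq_of_lt hj]

theorem rot_ne_self (hm : 2 ≤ m) (i : Fin m) : rot m i ≠ i := by
  intro h
  have hi := i.isLt
  have h1 : (i.val + 1) % m = i.val := congrArg Fin.val h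
  rcases Nat.lt_or_ge (i.val + 1) m with h2 | h2
  · rw [Nat.mod_eq_of_lt h2] at h1; omega
  · rw [show i.val + 1 = m by omega, Nat.mod_self] at h1; omega

theorem rot_symm_ne_self (hm : 2 ≤ m) (i : Fin m) : (rot m).symm i ≠ i := by
  intro h
  exact rot_ne_self hm i ((Equiv.symm_apply_eq _).1 h).symm

theorem eq_univ_of_rot_mem {A : Finset (Fin m)} (hA : A.Nonempty)
    (h : ∀ i ∈ A, rot m i ∈ A) : A = Finset.univ := by
  obtain ⟨i, hi⟩ := hA
  refine Finset.eq_univ_of_forall fun j => ?_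
  obtain ⟨l, -, rfl⟩ := exists_shift_eq i j
  induction l with
  | zero => rwa [shift_zero]
  | succ l ih => rw [shift_succ]; exact h _ ih

end Rotation

/-! ### Topplings on the wheel and termination -/

section Wheel

variable {m : ℕ}

theorem graphOfEnds_inc {α β : Type*} (ends : β → Sym2 α) (e : β) (x : α) :
    (graphOfEnds ends).Inc e x ↔ x ∈ ends e :=
  ⟨fun ⟨y, h⟩ => ⟨y, Eq.symm (a := s(x, y)) h⟩, fun ⟨y, h⟩ => ⟨y, Eq.symm h⟩⟩

theorem edgesAt_wheel (i : Fin m) : edgesAt (wheel m) (some i) =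
    {Sum.inl i, Sum.inr i, Sum.inr ((rot m).symm i)} := by
  ext e
  rcases e with j | j
  · simp [edgesAt, wheel, graphOfEnds_inc, eq_comm]
  · simp [edgesAt, wheel, graphOfEnds_inc, shift_one, Equiv.eq_symm_apply, eq_comm]

/-- When `m = 2` the two neighbours of `i` coincide, but its two cycle edges remain distinct;
indexing by edges covers this case too. -/
theorem sum_edgesAt_wheel (hm : 2 ≤ m) (i : Fin m) (f : Fin m ⊕ Fin m → ℕ) :
    ∑ e ∈ edgesAt (wheel m) (some i), f e =
      f (Sum.inl i) + f (Sum.inr i) + f (Sum.inr ((rot m).symm i)) := by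
  rw [edgesAt_wheel, Finset.sum_insert (by simp), Finset.sum_insert (by
    simpa using (rot_symm_ne_self hm i).symm), Finset.sum_singleton, add_assoc]

theorem deg_wheel (hm : 2 ≤ m) (i : Fin m) : deg (wheel m) (some i) = 3 := by
  rw [deg, Finset.card_eq_sum_ones, sum_edgesAt_wheel hm]

theorem level_wheel (c : Config (Fin m)) : level (wheel m) c = (∑ i, (c i : ℤ)) - m := by
  have h1 : edgesAt (wheel m) none = Finset.univ.map Function.Embedding.inl := by
    ext e
    rcases e with j | j <;> simp [edgesAt, wheel, graphOfEnds_inc]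
  have h2 : (wheel m).edgeSet = Set.univ :=
    Set.eq_univ_of_forall fun e =>
      ((wheel m).edge_mem_iff_exists_isLink e).2
        ⟨_, _, (Quot.out_eq (Sum.elim (fun i => s(none, some i))
          (fun i => s(some i, some (shift i 1))) e : Sym2 (Option (Fin m))))⟩
  rw [level, deg, h1, h2, Set.ncard_univ, Finset.card_map, Nat.card_eq_fintype_card]
  simp

theorem mem_stable_wheel (hm : 2 ≤ m) {c : Config (Fin m)} :
    c ∈ Stable (wheel m) ↔ ∀ i, c i < 3 := by
  simp [Stable, deg_wheel hm]

theorem mem_unstable_wheel (hm : 2 ≤ m) {c : Config (Fin m)} {i : Fin m} :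
    i ∈ unstable (wheel m) c ↔ 3 ≤ c i := by
  simp [unstable, deg_wheel hm]

theorem send_wheel (hm : 2 ≤ m) {i : Fin m} {A : Finset (Fin m ⊕ Fin m)}
    (hA : A ⊆ edgesAt (wheel m) (some i)) (c : Config (Fin m)) (j : Fin m) :
    send (wheel m) i A c j = if j = i then
        c i - ((if Sum.inl i ∈ A then 1 else 0) + (if Sum.inr i ∈ A then 1 else 0) +
          (if Sum.inr ((rot m).symm i) ∈ A then 1 else 0))
      else c j + ((if Sum.inr i ∈ A ∧ j = rot m i then 1 else 0) +
        (if Sum.inr ((rot m).symm i) ∈ A ∧ j = (rot m).symm i then 1 else 0)) := by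
  classical
  have h1 : ∀ q : Fin m ⊕ Fin m → Prop, (A.filter q).card =
      ∑ e ∈ edgesAt (wheel m) (some i), if e ∈ A ∧ q e then 1 else 0 := by
    intro q
    rw [Finset.card_eq_sum_ones, ← Finset.sum_filter]
    refine Finset.sum_congr ?_ fun _ _ => rfl
    ext e
    simp only [Finset.mem_filter]
    exact ⟨fun h => ⟨hA h.1, h⟩, fun h => h.2⟩
  have h2 : A.card = ∑ e ∈ edgesAt (wheel m) (some i), if e ∈ A then 1 else 0 := by
    have := h1 fun _ => True
    simpa using this
  rw [send]
  by_cases hj : j = i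
  · rw [if_pos hj, if_pos hj, h2, sum_edgesAt_wheel hm]
  · rw [if_neg hj, if_neg hj, h1, sum_edgesAt_wheel hm]
    have h3 : ¬ (wheel m).Inc (Sum.inl i) (some j) := by simp [wheel, graphOfEnds_inc, hj]
    have h4 : (wheel m).Inc (Sum.inr i) (some j) ↔ j = rot m i := by
      simp [wheel, graphOfEnds_inc, hj, shift_one]
    have h5 : (wheel m).Inc (Sum.inr ((rot m).symm i)) (some j) ↔ j = (rot m).symm i := by
      simp [wheel, graphOfEnds_inc, hj, shift_one]
    simp only [h3, h4, h5, and_false, if_false, zero_add]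

/-- The configuration after the vertex `i` has sent a grain along each incident edge. -/
abbrev fire (i : Fin m) (c : Config (Fin m)) : Config (Fin m) :=
  send (wheel m) i (edgesAt (wheel m) (some i)) c

theorem fire_apply (hm : 2 ≤ m) (i j : Fin m) (c : Config (Fin m)) :
    fire i c j = if j = i then c i - 3 else
      c j + ((if j = rot m i then 1 else 0) + (if j = (rot m).symm i then 1 else 0)) := by
  rw [fire, send_wheel hm subset_rfl]
  simp [edgesAt_wheel]

/-- Grains are only moved, except the one that may go to the sink. This bounds every random
trajectory and makes abelian topplings terminate. -/
theorem sum_send_le (hm : 2 ≤ m) {i : Fin m} {A : Finset (Fin m ⊕ Fin m)}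
    (hA : A ⊆ edgesAt (wheel m) (some i)) {c : Config (Fin m)} (hc : 3 ≤ c i) :
    ∑ j, send (wheel m) i A c j + (if Sum.inl i ∈ A then 1 else 0) ≤ ∑ j, c j := by
  classical
  rw [← Finset.add_sum_erase _ _ (Finset.mem_univ i), ← Finset.add_sum_erase _ c (Finset.mem_univ i)]
  have h : ∑ j ∈ Finset.univ.erase i, send (wheel m) i A c j ≤ ∑ j ∈ Finset.univ.erase i, c j +
      ((if Sum.inr i ∈ A then 1 else 0) + (if Sum.inr ((rot m).symm i) ∈ A then 1 else 0)) := by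
    rw [Finset.sum_congr rfl fun j hj => (send_wheel hm hA c j).trans
      (if_neg (Finset.ne_of_mem_erase hj)), Finset.sum_add_distrib, Finset.sum_add_distrib]
    simp only [ite_and, Finset.sum_ite_irrel, Finset.sum_const_zero, Finset.sum_ite_eq']
    split_ifs <;> omega
  have h2 := send_wheel hm hA c i
  rw [if_pos rfl] at h2
  rw [h2]
  split_ifs at h ⊢ <;> omega

theorem topple_wheel {c : Config (Fin m)} (hm : 2 ≤ m) (hc : c ∉ Stable (wheel m)) :
    ∃ i, 3 ≤ c i ∧ topple (wheel m) c = fire i c := by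
  have h := (unstable_nonempty_iff (wheel m)).2 hc
  exact ⟨_, (mem_unstable_wheel hm).1 (Finset.min'_mem _ h), by rw [topple, dif_pos h]⟩

theorem exists_iterate_topple_mem_stable (hm : 2 ≤ m) (c : Config (Fin m)) :
    ∃ t, (topple (wheel m))^[t] c ∈ Stable (wheel m) := by
  induction h : ∑ j, c j using Nat.strong_induction_on generalizing c with
  | _ N ih =>
    by_cases hc : c ∈ Stable (wheel m)
    · exact ⟨0, hc⟩
    · obtain ⟨i, hi, htop⟩ := topple_wheel hm hc
      have h2 := sum_send_le hm (subset_refl (edgesAt (wheel m) (some i))) hi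
      rw [if_pos (by simp [edgesAt_wheel])] at h2
      obtain ⟨t, ht⟩ := ih _ (by rw [← h, htop]; exact h2) (topple (wheel m) c) rfl
      exact ⟨t + 1, ht⟩

theorem finite_reach_toppleKernel (hm : 2 ≤ m) {p : unitInterval} (hp0 : 0 < p) (hp1 : p < 1)
    (c : Config (Fin m)) : {y | Reach (toppleKernel (wheel m) p) c y}.Finite := by
  refine (Set.finite_Iic (fun _ : Fin m => ∑ j, c j)).subset fun y hy => ?_
  have h : ∑ j, y j ≤ ∑ j, c j := by
    replace hy : Reach (toppleKernel (wheel m) p) c y := hy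
    induction hy with
    | refl => exact le_rfl
    | tail _ h ih =>
      rcases posStep_toppleKernel _ hp0 hp1 h with ⟨_, rfl⟩ | ⟨i, hi, A, hA, rfl⟩
      · exact ih
      · have := sum_send_le hm hA ((mem_unstable_wheel hm).1 hi)
        omega
  exact fun i => (Finset.single_le_sum (fun _ _ => Nat.zero_le _) (Finset.mem_univ i)).trans h

end Wheel

/-! ### Confluence of abelian topplings -/

section Abelian

variable {m : ℕ}

/-- A legal toppling of one unstable vertex of the wheel. -/
def FireStep (c d : Config (Fin m)) : Prop := ∃ i, 3 ≤ c i ∧ d = fire i c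

/-- The two lower bounds keep the truncated subtractions exact in either order. -/
theorem fire_comm (hm : 2 ≤ m) {i j : Fin m} (hij : i ≠ j) {c : Config (Fin m)} (hi : 3 ≤ c i)
    (hj : 3 ≤ c j) : fire i (fire j c) = fire j (fire i c) := by
  ext k
  simp only [fire_apply hm]
  by_cases hki : k = i
  · subst hki
    simp only [if_true, if_neg hij]
    omega
  · by_cases hkj : k = j
    · subst hkj
      simp only [if_true, if_neg hki]
      omega
    · simp only [if_neg hki, if_neg hkj]
      omega

theorem le_fire (hm : 2 ≤ m) {i j : Fin m} (hij : j ≠ i) (c : Config (Fin m)) :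
    c j ≤ fire i c j := by
  rw [fire_apply hm, if_neg hij]
  exact Nat.le_add_right _ _

/-- Firing one vertex never lowers another, so two unstable vertices can be fired in either order.
-/
theorem FireStep.diamond (hm : 2 ≤ m) (a b c : Config (Fin m)) (hab : FireStep a b)
    (hac : FireStep a c) :
    ∃ d, Relation.ReflGen FireStep b d ∧ Relation.ReflTransGen FireStep c d := by
  obtain ⟨i, hi, rfl⟩ := hab
  obtain ⟨j, hj, rfl⟩ := hac
  rcases eq_or_ne i j with rfl | hij
  · exact ⟨_, .refl, .refl⟩
  · refine ⟨fire j (fire i a), .single ⟨j, hj.trans (le_fire hm hij.symm a), rfl⟩,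
      .single ⟨i, hi.trans (le_fire hm hij a), (fire_comm hm hij hi hj).symm⟩⟩

theorem FireStep.eq_of_stable (hm : 2 ≤ m) {c d : Config (Fin m)} (hc : c ∈ Stable (wheel m))
    (h : Relation.ReflTransGen FireStep c d) : d = c := by
  induction h with
  | refl => rfl
  | tail _ h ih =>
    subst ih
    obtain ⟨i, hi, -⟩ := h
    exact absurd ((mem_stable_wheel hm).1 hc i) (not_lt.2 hi)

theorem reflTransGen_fireStep_stabilise (hm : 2 ≤ m) (c : Config (Fin m)) :
    Relation.ReflTransGen FireStep c (stabilise (wheel m) c) := by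
  unfold stabilise
  generalize sInf {t | (topple (wheel m))^[t] c ∈ Stable (wheel m)} = t
  induction t with
  | zero => exact .refl
  | succ t ih =>
    rw [Function.iterate_succ_apply']
    by_cases h : (topple (wheel m))^[t] c ∈ Stable (wheel m)
    · rw [topple, dif_neg (by rw [unstable_nonempty_iff, not_not]; exact h)]
      exact ih
    · exact ih.tail (topple_wheel hm h)

/-- By Church–Rosser the stable endpoint is unique, so any legal order of topplings may replace the
one fixed in `topple`. -/
theorem stabilise_eq_of_reflTransGen (hm : 2 ≤ m) {c d : Config (Fin m)}
    (h : Relation.ReflTransGen FireStep c d) (hd : d ∈ Stable (wheel m)) :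
    stabilise (wheel m) c = d := by
  obtain ⟨e, h1, h2⟩ := Relation.church_rosser (FireStep.diamond hm)
    (reflTransGen_fireStep_stabilise hm c) h
  rw [← FireStep.eq_of_stable hm
    (stabilise_mem_stable (wheel m) (exists_iterate_topple_mem_stable hm) c) h1,
    FireStep.eq_of_stable hm hd h2]

theorem FireStep.add_right (hm : 2 ≤ m) {c d : Config (Fin m)} (x : Config (Fin m))
    (h : FireStep c d) : FireStep (c + x) (d + x) := by
  obtain ⟨i, hi, rfl⟩ := h
  refine ⟨i, hi.trans (Nat.le_add_right _ _), ?_⟩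
  ext j
  rw [Pi.add_apply, fire_apply hm, fire_apply hm, Pi.add_apply, Pi.add_apply]
  split_ifs with h
  all_goals first | (subst h; omega) | omega

theorem reflTransGen_fireStep_add_right (hm : 2 ≤ m) {c d : Config (Fin m)} (x : Config (Fin m))
    (h : Relation.ReflTransGen FireStep c d) :
    Relation.ReflTransGen FireStep (c + x) (d + x) := by
  induction h with
  | refl => exact .refl
  | tail _ h ih => exact ih.tail (h.add_right hm x)

theorem stabilise_stabilise_add (hm : 2 ≤ m) (c x : Config (Fin m)) :
    stabilise (wheel m) (stabilise (wheel m) c + x) = stabilise (wheel m) (c + x) :=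
  (stabilise_eq_of_reflTransGen hm ((reflTransGen_fireStep_add_right hm x
    (reflTransGen_fireStep_stabilise hm c)).trans (reflTransGen_fireStep_stabilise hm _))
    (stabilise_mem_stable (wheel m) (exists_iterate_topple_mem_stable hm) _)).symm

theorem stabilise_of_mem_stable (hm : 2 ≤ m) {c : Config (Fin m)} (hc : c ∈ Stable (wheel m)) :
    stabilise (wheel m) c = c :=
  stabilise_eq_of_reflTransGen hm .refl hc

end Abelian

/-! ### Edge-bounded configurations and the burning test -/

section Recurrence

variable {m : ℕ}

/-- On every set of vertices, the configuration has at least as many grains as there are edges of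
the cycle inside the set. -/
def EdgeBounded (c : Config (Fin m)) : Prop :=
  ∀ A : Finset (Fin m), (A.filter fun i => rot m i ∈ A).card ≤ ∑ i ∈ A, c i

theorem EdgeBounded.mono {c d : Config (Fin m)} (h : EdgeBounded c) (hcd : c ≤ d) :
    EdgeBounded d := fun A => (h A).trans (Finset.sum_le_sum fun i _ => hcd i)

theorem edgeBounded_two : EdgeBounded (fun _ : Fin m => 2) := fun A => by
  have := Finset.card_filter_le A fun i => rot m i ∈ A
  simp only [Finset.sum_const, smul_eq_mul]
  omega

theorem card_filter_rot_le (A : Finset (Fin m)) (i : Fin m) :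
    (A.filter fun j => rot m j ∈ A).card ≤
      ((A.erase i).filter fun j => rot m j ∈ A.erase i).card +
        ((if rot m i ∈ A then 1 else 0) + (if (rot m).symm i ∈ A then 1 else 0)) := by
  have h : (A.filter fun j => rot m j ∈ A) ⊆
      ((A.erase i).filter fun j => rot m j ∈ A.erase i) ∪
        ((if rot m i ∈ A then {i} else ∅) ∪
          (if (rot m).symm i ∈ A then {(rot m).symm i} else ∅)) := by
    intro j hj
    rw [Finset.mem_filter] at hj
    simp only [Finset.mem_union, Finset.mem_filter, Finset.mem_erase]
    by_cases hji : j = i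
    · subst hji
      simp [hj.2]
    · by_cases hr : rot m j = i
      · subst hr
        simp [hj.1]
      · exact .inl ⟨⟨hji, hj.1⟩, hr, hj.2⟩
  refine (Finset.card_le_card h).trans ((Finset.card_union_le _ _).trans ?_)
  refine Nat.add_le_add_left ((Finset.card_union_le _ _).trans (le_of_eq ?_)) _
  split_ifs <;> simp

/-- If `i ∉ A`, then `A` loses nothing. If `i ∈ A`, apply the bound to `A.erase i`: of three grains
at `i`, one is assigned to each incident edge, and a grain assigned to a cycle edge leading into `A`
stays in `A` whether or not it is sent. These grains pay for the edges restored with `i`. -/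
theorem EdgeBounded.send (hm : 2 ≤ m) {c : Config (Fin m)} (h : EdgeBounded c) {i : Fin m}
    (hi : 3 ≤ c i) {B : Finset (Fin m ⊕ Fin m)} (hB : B ⊆ edgesAt (wheel m) (some i)) :
    EdgeBounded (send (wheel m) i B c) := by
  intro A
  have hi' := send_wheel hm hB c i
  rw [if_pos rfl] at hi'
  by_cases hiA : i ∈ A
  · have h1 := card_filter_rot_le A i
    have h2 := h (A.erase i)
    have h3 : ∑ j ∈ A.erase i, Sandpile.send (wheel m) i B c j = ∑ j ∈ A.erase i, c j +
        ((if Sum.inr i ∈ B ∧ rot m i ∈ A then 1 else 0) +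
          (if Sum.inr ((rot m).symm i) ∈ B ∧ (rot m).symm i ∈ A then 1 else 0)) := by
      rw [Finset.sum_congr rfl fun j hj => (send_wheel hm hB c j).trans
        (if_neg (Finset.ne_of_mem_erase hj)), Finset.sum_add_distrib, Finset.sum_add_distrib]
      simp only [ite_and, Finset.sum_ite_irrel, Finset.sum_const_zero, Finset.sum_ite_eq',
        Finset.mem_erase, ne_eq, rot_ne_self hm i, rot_symm_ne_self hm i, not_false_eq_true,
        true_and]
    rw [← Finset.add_sum_erase A _ hiA, h3, hi']
    simp only [ite_and]
    split_ifs at h1 ⊢ <;> omega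
  · refine (h A).trans (Finset.sum_le_sum fun j hj => ?_)
    rw [send_wheel hm hB, if_neg (ne_of_mem_of_not_mem hj hiA)]
    exact Nat.le_add_right _ _

theorem EdgeBounded.stabilise (hm : 2 ≤ m) {c : Config (Fin m)} (h : EdgeBounded c) :
    EdgeBounded (stabilise (wheel m) c) := by
  have hs := reflTransGen_fireStep_stabilise hm c
  revert hs
  generalize Sandpile.stabilise (wheel m) c = d
  intro hs
  induction hs with
  | refl => exact h
  | tail _ hs ih =>
    obtain ⟨i, hi, rfl⟩ := hs
    exact ih.send hm hi subset_rfl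

theorem EdgeBounded.of_reach_toppleKernel (hm : 2 ≤ m) {p : unitInterval} (hp0 : 0 < p)
    (hp1 : p < 1) {c d : Config (Fin m)} (h : EdgeBounded c)
    (hcd : Reach (toppleKernel (wheel m) p) c d) : EdgeBounded d := by
  induction hcd with
  | refl => exact h
  | tail _ hs ih =>
    rcases posStep_toppleKernel _ hp0 hp1 hs with ⟨_, rfl⟩ | ⟨i, hi, A, hA, rfl⟩
    · exact ih
    · exact ih.send hm ((mem_unstable_wheel hm).1 hi) hA

theorem card_filter_rot_symm (A : Finset (Fin m)) :
    (A.filter fun i => (rot m).symm i ∈ A).card = (A.filter fun i => rot m i ∈ A).card := by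
  refine Finset.card_bij' (fun i _ => (rot m).symm i) (fun i _ => rot m i) ?_ ?_ ?_ ?_ <;>
    simp +contextual

/-- Otherwise each vertex of `A` has fewer grains than neighbours in `A`; summing, grains plus `|A|`
is at most twice the number of inner edges. As grains are at least inner edges, there are at least
`|A|` inner edges, so `A` is the whole cycle and carries at most `m` grains. -/
theorem EdgeBounded.exists_le {c : Config (Fin m)} (h : EdgeBounded c)
    (hsum : m < ∑ i, c i) {A : Finset (Fin m)} (hA : A.Nonempty) :
    ∃ i ∈ A, (if rot m i ∈ A then 1 else 0) + (if (rot m).symm i ∈ A then 1 else 0) ≤ c i := by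
  by_contra! hc
  have h1 : ∑ i ∈ A, (c i + 1) ≤ ∑ i ∈ A, ((if rot m i ∈ A then 1 else 0) +
      (if (rot m).symm i ∈ A then 1 else 0)) := Finset.sum_le_sum hc
  rw [Finset.sum_add_distrib, Finset.sum_add_distrib, ← Finset.card_filter, ← Finset.card_filter,
    card_filter_rot_symm, ← Finset.card_eq_sum_ones] at h1
  have h2 := h A
  have h3 : (A.filter fun i => rot m i ∈ A) = A :=
    Finset.eq_of_subset_of_card_le (Finset.filter_subset _ _) (by omega)
  have h4 := eq_univ_of_rot_mem hA fun i hi => (Finset.filter_eq_self.1 h3) i hi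
  rw [h3] at h1
  rw [h4, Finset.card_univ, Fintype.card_fin] at h1
  omega

theorem exists_unburnt {c : Config (Fin m)} (h : EdgeBounded c)
    (hsum : m < ∑ i, c i) {T : Finset (Fin m)} (hT : T ≠ Finset.univ) :
    ∃ i, i ∉ T ∧
      3 ≤ c i + 1 + ((if rot m i ∈ T then 1 else 0) + (if (rot m).symm i ∈ T then 1 else 0)) := by
  obtain ⟨i, hi, h1⟩ := h.exists_le hsum (A := Tᶜ) (by
    rwa [Finset.nonempty_iff_ne_empty, ne_eq, Finset.compl_eq_empty_iff])
  refine ⟨i, Finset.mem_compl.1 hi, ?_⟩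
  simp only [Finset.mem_compl, ite_not] at h1
  split_ifs at h1 ⊢ <;> omega

/-- Dhar's burning algorithm. The displayed configuration is `c + 1` after each vertex of `T` has
fired once; an unburnt vertex that can fire always exists, and once all have fired each vertex has
gained 1 + 2 and lost 3. -/
theorem reflTransGen_fireStep_burn (hm : 2 ≤ m) {c : Config (Fin m)} (h : EdgeBounded c)
    (hsum : m < ∑ i, c i) (T : Finset (Fin m))
    (hT : ∀ i ∈ T, 3 ≤ c i + 1 +
      ((if rot m i ∈ T then 1 else 0) + (if (rot m).symm i ∈ T then 1 else 0))) :
    Relation.ReflTransGen FireStep (fun i => c i + 1 +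
      ((if rot m i ∈ T then 1 else 0) + (if (rot m).symm i ∈ T then 1 else 0)) -
        (if i ∈ T then 3 else 0)) c := by
  induction hN : Tᶜ.card using Nat.strong_induction_on generalizing T with
  | _ N ih =>
    by_cases huniv : T = Finset.univ
    · subst huniv
      simp only [Finset.mem_univ, if_true]
      convert Relation.ReflTransGen.refl using 2
      omega
    · obtain ⟨i, hi, hi3⟩ := exists_unburnt h hsum huniv
      have hmem : ∀ k, ((if rot m k ∈ insert i T then 1 else 0) +
          (if (rot m).symm k ∈ insert i T then 1 else 0) : ℕ) =
          ((if rot m k ∈ T then 1 else 0) + (if (rot m).symm k ∈ T then 1 else 0)) +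
          ((if k = rot m i then 1 else 0) + (if k = (rot m).symm i then 1 else 0)) := by
        intro k
        have e1 : k = rot m i ↔ (rot m).symm k = i := (Equiv.symm_apply_eq _).symm
        have e2 : k = (rot m).symm i ↔ rot m k = i := Equiv.eq_symm_apply _
        simp only [e1, e2, Finset.mem_insert]
        by_cases a1 : rot m k = i <;> by_cases a2 : (rot m).symm k = i <;>
          simp [a1, a2, hi]; omega
      refine .head ⟨i, ?_, ?_⟩ (ih _ ?_ (insert i T) ?_ rfl)
      · simpa [hi] using hi3
      · ext k
        rw [fire_apply hm]
        simp only [hmem, hi, if_false]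
        by_cases hk : k = i
        · subst hk
          simp [(rot_ne_self hm k).symm, (rot_symm_ne_self hm k).symm]
        · rw [if_neg hk]
          by_cases hkT : k ∈ T
          · have := hT k hkT
            simp only [Finset.mem_insert, hkT, or_true, if_true]
            omega
          · simp only [Finset.mem_insert, hkT, hk, or_false, if_false]
            omega
      · rw [← hN]
        exact Finset.card_lt_card (Finset.compl_ssubset_compl.2 (Finset.ssubset_insert hi))
      · intro k hk
        rw [hmem]
        rcases Finset.mem_insert.1 hk with rfl | hk
        · omega
        · have := hT k hk
          omega

/-- Burning twice removes the added all-2 configuration, which shows that adding the grains of `c`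
to all-2 leads to `c`. -/
theorem stabilise_two_add (hm : 2 ≤ m) {c : Config (Fin m)} (hc : c ∈ Stable (wheel m))
    (h : EdgeBounded c) (hsum : m < ∑ i, c i) :
    stabilise (wheel m) ((fun _ => 2) + c) = c := by
  have h1 : Relation.ReflTransGen FireStep (c + fun _ => 1) c := by
    have h0 := reflTransGen_fireStep_burn hm h hsum ∅ (by simp)
    simp only [Finset.notMem_empty, if_false, add_zero, tsub_zero] at h0
    exact h0
  refine stabilise_eq_of_reflTransGen hm ?_ hc
  have h2 := (reflTransGen_fireStep_add_right hm (fun _ => 1) h1).trans h1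
  convert h2 using 1
  ext i
  simp only [Pi.add_apply]
  omega

theorem two_mem_stable (hm : 2 ≤ m) : (fun _ => 2 : Config (Fin m)) ∈ Stable (wheel m) :=
  (mem_stable_wheel hm).2 fun _ => by norm_num

theorem finite_stable (hm : 2 ≤ m) : (Stable (wheel m)).Finite :=
  (Set.finite_Iic (fun _ : Fin m => 2)).subset fun _ hc i =>
    Nat.le_of_lt_succ ((mem_stable_wheel hm).1 hc i)

variable {K : Kernel (Config (Fin m)) (Config (Fin m))}

/-- By the abelian property, adding `x` grain by grain with stabilisation in between gives the same
result as adding it at once. `hK` holds for both models. -/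
theorem reach_stabilise_add (hm : 2 ≤ m)
    (hK : ∀ c ∈ Stable (wheel m), ∀ i, PosStep K c (stabilise (wheel m) (c + Pi.single i 1)))
    {c : Config (Fin m)} (hc : c ∈ Stable (wheel m)) (x : Config (Fin m)) :
    Reach K c (stabilise (wheel m) (c + x)) := by
  induction hN : ∑ i, x i generalizing x with
  | zero =>
    have : x = 0 := by
      ext i
      simpa using (Finset.sum_eq_zero_iff.1 hN) i (Finset.mem_univ i)
    rw [this, add_zero, stabilise_of_mem_stable hm hc]
  | succ N ih =>
    obtain ⟨i, -, hi⟩ : ∃ i ∈ Finset.univ, x i ≠ 0 :=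
      Finset.exists_ne_zero_of_sum_ne_zero (by rw [hN]; exact Nat.succ_ne_zero N)
    have hx : x = (x - Pi.single i 1) + Pi.single i 1 := by
      refine (tsub_add_cancel_of_le fun j => ?_).symm
      by_cases hj : j = i
      · subst hj; simpa using Nat.one_le_iff_ne_zero.2 hi
      · simp [hj]
    have h1 := ih (x - Pi.single i 1) (by
      rw [hx] at hN
      simp only [Pi.add_apply, Finset.sum_add_distrib, Finset.sum_pi_single'] at hN
      simpa using hN)
    rw [hx, ← add_assoc, ← stabilise_stabilise_add hm]
    exact h1.tail (hK _ (stabilise_mem_stable _ (exists_iterate_topple_mem_stable hm) _) i)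

theorem reach_two (hm : 2 ≤ m)
    (hK : ∀ c ∈ Stable (wheel m), ∀ i, PosStep K c (stabilise (wheel m) (c + Pi.single i 1)))
    {c : Config (Fin m)} (hc : c ∈ Stable (wheel m)) : Reach K c (fun _ => 2) := by
  have h := reach_stabilise_add hm hK hc ((fun _ => 2) - c)
  rwa [add_tsub_cancel_of_le fun i => Nat.le_of_lt_succ ((mem_stable_wheel hm).1 hc i),
    stabilise_of_mem_stable hm (two_mem_stable hm)] at h

/-- All-2 is reachable from every stable configuration, so recurrence of `c` amounts to `c` being
reachable from all-2: edge-boundedness is inherited along such a path, and burning provides one. -/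
theorem isRecurrent_iff_edgeBounded [IsMarkovKernel K] (hm : 2 ≤ m)
    (hK : ∀ c ∈ Stable (wheel m), ∀ i, PosStep K c (stabilise (wheel m) (c + Pi.single i 1)))
    (hK' : ∀ c ∈ Stable (wheel m), ∀ d, PosStep K c d →
      d ∈ Stable (wheel m) ∧ (EdgeBounded c → EdgeBounded d))
    {c : Config (Fin m)} (hc : c ∈ Stable (wheel m)) (hsum : m < ∑ i, c i) :
    IsRecurrent K c ↔ EdgeBounded c := by
  have hreach : ∀ a ∈ Stable (wheel m), ∀ b, Reach K a b →
      b ∈ Stable (wheel m) ∧ (EdgeBounded a → EdgeBounded b) := by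
    intro a ha b hab
    induction hab with
    | refl => exact ⟨ha, id⟩
    | tail _ h ih =>
      have := hK' _ ih.1 _ h
      exact ⟨this.1, this.2 ∘ ih.2⟩
  constructor
  · intro h
    exact (hreach _ (two_mem_stable hm) _
      (reach_of_isRecurrent K c h (reach_two hm hK hc))).2 edgeBounded_two
  · intro h
    have h1 : Reach K (fun _ => 2) c := by
      have := reach_stabilise_add hm hK (two_mem_stable hm) c
      rwa [stabilise_two_add hm hc h hsum] at this
    exact ae_frequently_mem K c (T := {c})
      ((finite_stable hm).subset fun y hy => (hreach c hc y hy).1)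
      fun y hy => ⟨c, rfl, (reach_two hm hK (hreach c hc y hy).1).trans h1⟩

variable {μ : PMF (Fin m)}

theorem mem_ASMRec_iff (hm : 2 ≤ m) (hμ : ∀ i, 0 < μ i) {c : Config (Fin m)}
    (hsum : m < ∑ i, c i) :
    c ∈ ASMRec (wheel m) μ ↔ c ∈ Stable (wheel m) ∧ EdgeBounded c := by
  refine and_congr_right fun hc => isRecurrent_iff_edgeBounded hm ?_ ?_ hc hsum
  · exact fun c _ i => (posStep_asmKernel_iff _ hμ).2 ⟨i, rfl⟩
  · intro c hc d h
    obtain ⟨i, rfl⟩ := (posStep_asmKernel_iff _ hμ).1 h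
    exact ⟨stabilise_mem_stable _ (exists_iterate_topple_mem_stable hm) _,
      fun h => (h.mono le_self_add).stabilise hm⟩

theorem mem_SSMRec_iff (hm : 2 ≤ m) (hμ : ∀ i, 0 < μ i) {p : unitInterval} (hp0 : 0 < p)
    (hp1 : p < 1) {c : Config (Fin m)} (hsum : m < ∑ i, c i) :
    c ∈ SSMRec (wheel m) μ p ↔ c ∈ Stable (wheel m) ∧ EdgeBounded c := by
  have hstep := fun c d => posStep_ssmKernel_iff (wheel m) (exists_iterate_topple_mem_stable hm)
    hμ hp0 hp1 (c := c) (d := d) (finite_reach_toppleKernel hm hp0 hp1)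
  refine and_congr_right fun hc => isRecurrent_iff_edgeBounded hm ?_ ?_ hc hsum
  · exact fun c _ i => (hstep _ _).2 ⟨stabilise_mem_stable _
      (exists_iterate_topple_mem_stable hm) _, i, reach_toppleKernel_iterate _ hp0 hp1 _ _⟩
  · intro c hc d h
    obtain ⟨hd, i, hi⟩ := (hstep _ _).1 h
    exact ⟨hd, fun h => (h.mono le_self_add).of_reach_toppleKernel hm hp0 hp1 hi⟩

end Recurrence

/-! ### Vertices covered by `01*`-chains -/

section ChainMembership

variable {m : ℕ}

/-- Membership in a `01*`-chain, generated by following the chain clockwise. -/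
inductive InChain (c : Config (Fin m)) : Fin m → Prop
  | zero {j : Fin m} (h : c j = 0) : InChain c j
  | succ {j : Fin m} (hj : InChain c j) (h : c (rot m j) = 1) : InChain c (rot m j)

theorem inChain_iff {c : Config (Fin m)} {i : Fin m} :
    InChain c i ↔ ∃ A, IsChain01 c A ∧ i ∈ A := by
  constructor
  · intro h
    suffices ∃ (j : Fin m) (k : ℕ), c j = 0 ∧ (∀ l, 1 ≤ l → l ≤ k → c (shift j l) = 1) ∧
        shift j k = i by
      obtain ⟨j, k, h0, h1, rfl⟩ := this
      exact ⟨_, ⟨j, k, h0, h1, rfl⟩, Finset.mem_image_of_mem _ (Finset.self_mem_range_succ k)⟩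
    induction h with
    | @zero j h => exact ⟨j, 0, h, fun l h1 h2 => by omega, shift_zero j⟩
    | succ _ h ih =>
      obtain ⟨j, k, h0, h1, rfl⟩ := ih
      refine ⟨j, k + 1, h0, fun l hl hl' => ?_, shift_succ j k⟩
      rcases Nat.lt_or_ge k l with hkl | hkl
      · rw [show l = k + 1 by omega, shift_succ]
        exact h
      · exact h1 l hl hkl
  · rintro ⟨_, ⟨j, k, h0, h1, rfl⟩, hi⟩
    obtain ⟨l, hl, rfl⟩ := Finset.mem_image.1 hi
    rw [Finset.mem_range] at hl
    clear hi
    induction l with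
    | zero => exact .zero (by rwa [shift_zero])
    | succ l ih =>
      have h := h1 (l + 1) (by omega) (by omega)
      rw [shift_succ] at h ⊢
      exact .succ (ih (by omega)) h

theorem weight01_eq (c : Config (Fin m)) : weight01 c = {i | InChain c i}.ncard := by
  simp only [weight01, inChain_iff]

theorem InChain.le_one {c : Config (Fin m)} {i : Fin m} (h : InChain c i) : c i ≤ 1 := by
  cases h <;> omega

theorem InChain.of_rot {c : Config (Fin m)} {i : Fin m} (h : InChain c (rot m i))
    (h1 : c (rot m i) ≠ 0) : InChain c i := by
  generalize hj : rot m i = j at h h1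
  cases h with
  | zero h => exact absurd h h1
  | succ h _ => rwa [(rot m).injective hj]

/-- `B` is the chain from its 0 up to `i`, with one grain fewer than vertices. It cannot close up
around the cycle, as the total would then be below `m`. -/
theorem InChain.exists_set {c : Config (Fin m)} (hsum : m < ∑ i, c i) {i : Fin m}
    (h : InChain c i) : ∃ B : Finset (Fin m), i ∈ B ∧ rot m i ∉ B ∧ ∑ j ∈ B, c j + 1 ≤ B.card ∧
      ∀ b ∈ B, b ≠ i → rot m b ∈ B := by
  have key : ∀ (i : Fin m) (B : Finset (Fin m)), i ∈ B → ∑ j ∈ B, c j + 1 ≤ B.card →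
      (∀ b ∈ B, b ≠ i → rot m b ∈ B) → rot m i ∉ B := by
    intro i B hi h1 h2 h3
    have : B = Finset.univ := eq_univ_of_rot_mem ⟨i, hi⟩ fun b hb => by
      rcases eq_or_ne b i with rfl | hbi
      · exact h3
      · exact h2 b hb hbi
    rw [this, Finset.card_univ, Fintype.card_fin] at h1
    omega
  induction h with
  | @zero i h =>
    have h1 : ∑ j ∈ {i}, c j + 1 ≤ ({i} : Finset (Fin m)).card := by simp [h]
    have h2 : ∀ b ∈ ({i} : Finset (Fin m)), b ≠ i → rot m b ∈ ({i} : Finset (Fin m)) :=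
      fun b hb hbi => absurd (Finset.mem_singleton.1 hb) hbi
    exact ⟨{i}, Finset.mem_singleton_self i, key _ _ (Finset.mem_singleton_self i) h1 h2, h1, h2⟩
  | @succ i _ h ih =>
    obtain ⟨B, hi, hr, h1, h2⟩ := ih
    have h1' : ∑ j ∈ insert (rot m i) B, c j + 1 ≤ (insert (rot m i) B).card := by
      rw [Finset.sum_insert hr, Finset.card_insert_of_notMem hr]
      omega
    have h2' : ∀ b ∈ insert (rot m i) B, b ≠ rot m i → rot m b ∈ insert (rot m i) B := by
      intro b hb hbi
      rcases eq_or_ne b i with rfl | hbi'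
      · exact Finset.mem_insert_self _ _
      · exact Finset.mem_insert_of_mem (h2 b (Finset.mem_of_mem_insert_of_ne hb hbi) hbi')
    exact ⟨_, Finset.mem_insert_self _ _, key _ _ (Finset.mem_insert_self _ _) h1' h2', h1', h2'⟩

/-- A second 0 right after a chain `B` would give an arc with at least `|B|` edges but only `|B| -
1` grains. -/
theorem InChain.rot_ne_zero {c : Config (Fin m)} (hE : EdgeBounded c) (hsum : m < ∑ i, c i)
    {i : Fin m} (h : InChain c i) : c (rot m i) ≠ 0 := by
  intro h0
  obtain ⟨B, hi, hr, h1, h2⟩ := h.exists_set hsum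
  have h3 := hE (insert (rot m i) B)
  rw [Finset.sum_insert hr, h0, zero_add] at h3
  have h4 : B ⊆ (insert (rot m i) B).filter fun j => rot m j ∈ insert (rot m i) B := by
    intro b hb
    refine Finset.mem_filter.2 ⟨Finset.mem_insert_of_mem hb, ?_⟩
    rcases eq_or_ne b i with rfl | hbi
    · exact Finset.mem_insert_self _ _
    · exact Finset.mem_insert_of_mem (h2 b hb hbi)
  have h5 := Finset.card_le_card h4
  omega

end ChainMembership

/-! ### Bijection between configurations and subgraphs -/

section Pairs

variable {m : ℕ}

/-- The edges in `F` have both their ends in `A`. -/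
def IsSubPair (q : Finset (Fin m) × Finset (Fin m)) : Prop :=
  ∀ i ∈ q.2, i ∈ q.1 ∧ rot m i ∈ q.1

/-- The configuration attached to a subgraph of the cycle: its `01*`-chains cover the vertices that
are not in the subgraph. -/
def configOfPair (q : Finset (Fin m) × Finset (Fin m)) : Config (Fin m) := fun j =>
  if j ∈ q.1 then (if (rot m).symm j ∈ q.1 ∧ (rot m).symm j ∉ q.2 then 1 else 2)
  else (if (rot m).symm j ∈ q.1 then 0 else 1)

variable {q : Finset (Fin m) × Finset (Fin m)}

theorem configOfPair_rot (i : Fin m) : configOfPair q (rot m i) =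
    if rot m i ∈ q.1 then (if i ∈ q.1 ∧ i ∉ q.2 then 1 else 2)
    else (if i ∈ q.1 then 0 else 1) := by
  simp [configOfPair]

theorem configOfPair_mem_stable (hm : 2 ≤ m) : configOfPair q ∈ Stable (wheel m) := by
  rw [mem_stable_wheel hm]
  intro i
  unfold configOfPair
  split_ifs <;> omega

/-- The value at `rot m i` is 1, plus 1 if the edge `i` is present, plus a difference of indicators
of `q.1` at `rot m i` and `i`, which cancels around the cycle. -/
theorem sum_configOfPair (hq : IsSubPair q) : ∑ i, configOfPair q i = m + q.2.card := by
  have h1 : ∀ i : Fin m, configOfPair q (rot m i) + (if i ∈ q.1 then 1 else 0) =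
      1 + (if i ∈ q.2 then 1 else 0) + (if rot m i ∈ q.1 then 1 else 0) := by
    intro i
    rw [configOfPair_rot]
    have := hq i
    split_ifs <;> first | omega | tauto
  have h2 := Finset.sum_congr rfl fun i (_ : i ∈ Finset.univ) => h1 i
  rw [Finset.sum_add_distrib, Finset.sum_add_distrib, Finset.sum_add_distrib,
    Equiv.sum_comp (rot m) fun i => configOfPair q i,
    Equiv.sum_comp (rot m) fun i => if i ∈ q.1 then 1 else 0] at h2
  simp only [Finset.sum_const, Finset.card_univ, Fintype.card_fin, smul_eq_mul, mul_one,
    Finset.sum_ite_mem, Finset.univ_inter] at h2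
  omega

/-- Sum over `B` the bound of `c j` below by 1 plus the indicator of `q.1` at `j` minus that at its
predecessor. The negative terms with predecessor in `B` inject into the positive ones; the others
number at most `|B|` minus the edges inside `B`. -/
theorem edgeBounded_configOfPair : EdgeBounded (configOfPair q) := by
  intro B
  have h1 : ∀ j ∈ B, 1 + (if j ∈ q.1 then 1 else 0) ≤
      configOfPair q j + (if (rot m).symm j ∈ q.1 then 1 else 0) := by
    intro j _
    unfold configOfPair
    split_ifs <;> first | omega | tauto
  have h2 := Finset.sum_le_sum h1
  rw [Finset.sum_add_distrib, Finset.sum_add_distrib, ← Finset.card_filter, ← Finset.card_filter,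
    ← Finset.card_eq_sum_ones] at h2
  have h3 : (B.filter fun j => (rot m).symm j ∈ q.1).card ≤
      (B.filter fun j => j ∈ q.1).card + (B.filter fun j => ¬ (rot m).symm j ∈ B).card := by
    have h4 : (B.filter fun j => (rot m).symm j ∈ q.1 ∧ (rot m).symm j ∈ B).card ≤
        (B.filter fun j => j ∈ q.1).card :=
      Finset.card_le_card_of_injOn (rot m).symm
        (fun j hj => by
          have := (Finset.mem_filter.1 hj).2
          exact Finset.mem_coe.2 (Finset.mem_filter.2 ⟨this.2, this.1⟩))
        (rot m).symm.injective.injOn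
    refine (Finset.card_le_card ?_).trans ((Finset.card_union_le _ _).trans
      (Nat.add_le_add_right h4 _))
    intro j hj
    simp only [Finset.mem_union, Finset.mem_filter] at hj ⊢
    tauto
  have h5 := Finset.card_filter_add_card_filter_not (s := B) fun j => (rot m).symm j ∈ B
  rw [card_filter_rot_symm] at h5
  omega

/-- Clockwise from a present vertex, the first missing vertex of each gap has 0 and the rest have 1.
A present vertex never has 0, and has 1 only after a present vertex, so no chain enters it. -/
theorem inChain_configOfPair_iff (hq : q.1.Nonempty) {j : Fin m} :
    InChain (configOfPair q) j ↔ j ∉ q.1 := by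
  constructor
  · intro h
    induction h with
    | zero h =>
      intro hj
      unfold configOfPair at h
      rw [if_pos hj] at h
      split_ifs at h
    | succ _ h ih =>
      intro hj
      rw [configOfPair_rot, if_pos hj, if_neg fun h => ih h.1] at h
      omega
  · intro hj
    obtain ⟨a, ha⟩ := hq
    obtain ⟨l, -, rfl⟩ := exists_shift_eq a j
    induction l with
    | zero => exact absurd (by rwa [shift_zero]) hj
    | succ l ih =>
      rw [shift_succ] at hj ⊢
      by_cases hl : shift a l ∈ q.1
      · exact .zero (by rw [configOfPair_rot, if_neg hj, if_pos hl])
      · exact .succ (ih hl) (by rw [configOfPair_rot, if_neg hj, if_neg hl])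

theorem weight01_configOfPair (hq : q.1.Nonempty) :
    weight01 (configOfPair q) + q.1.card = m := by
  have h : {i | InChain (configOfPair q) i} = (↑(q.1ᶜ) : Set (Fin m)) := by
    ext i
    change InChain _ i ↔ _
    rw [inChain_configOfPair_iff hq, Finset.mem_coe, Finset.mem_compl]
  rw [weight01_eq, h, Set.ncard_coe_finset, Finset.card_compl_add_card, Fintype.card_fin]

open Classical in
/-- The subgraph of the cycle attached to a configuration. -/
def pairOfConfig (c : Config (Fin m)) : Finset (Fin m) × Finset (Fin m) :=
  (Finset.univ.filter fun j => ¬ InChain c j,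
    Finset.univ.filter fun i => ¬ InChain c i ∧ c (rot m i) = 2)

theorem mem_pairOfConfig_fst {c : Config (Fin m)} {j : Fin m} :
    j ∈ (pairOfConfig c).1 ↔ ¬ InChain c j := by
  simp [pairOfConfig]

theorem mem_pairOfConfig_snd {c : Config (Fin m)} {j : Fin m} :
    j ∈ (pairOfConfig c).2 ↔ ¬ InChain c j ∧ c (rot m j) = 2 := by
  simp [pairOfConfig]

theorem isSubPair_pairOfConfig (c : Config (Fin m)) : IsSubPair (pairOfConfig c) := by
  intro i hi
  rw [mem_pairOfConfig_snd] at hi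
  rw [mem_pairOfConfig_fst, mem_pairOfConfig_fst]
  refine ⟨hi.1, fun h => ?_⟩
  have := h.le_one
  omega

theorem pairOfConfig_fst_nonempty {c : Config (Fin m)} (hsum : m < ∑ i, c i) :
    (pairOfConfig c).1.Nonempty := by
  obtain ⟨i, -, hi⟩ := Finset.exists_lt_of_sum_lt (s := Finset.univ) (f := fun _ : Fin m => 1)
    (g := c) (by simpa using hsum)
  exact ⟨i, mem_pairOfConfig_fst.2 fun h => absurd h.le_one (not_le.2 hi)⟩

/-- The delicate case is a chain vertex following a chain vertex: its value must be 1, since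
edge-boundedness rules out 0. -/
theorem configOfPair_pairOfConfig (hm : 2 ≤ m) {c : Config (Fin m)} (hc : c ∈ Stable (wheel m))
    (hE : EdgeBounded c) (hsum : m < ∑ i, c i) : configOfPair (pairOfConfig c) = c := by
  classical
  ext j
  obtain ⟨i, rfl⟩ := (rot m).surjective j
  simp only [configOfPair_rot, mem_pairOfConfig_fst, mem_pairOfConfig_snd]
  have h3 := (mem_stable_wheel hm).1 hc (rot m i)
  by_cases hr : InChain c (rot m i)
  · have h1 := hr.le_one
    by_cases hi : InChain c i
    · have := hi.rot_ne_zero hE hsum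
      simp only [hr, hi, not_true_eq_false, if_false]
      omega
    · have : c (rot m i) = 0 := by
        by_contra h
        exact hi (hr.of_rot h)
      simp [hr, hi, this]
  · have h0 : c (rot m i) ≠ 0 := fun h => hr (.zero h)
    by_cases hi : InChain c i
    · have h1 : c (rot m i) ≠ 1 := fun h => hr (.succ hi h)
      simp only [hr, hi, not_true_eq_false, not_false_eq_true, false_and, if_false, if_true]
      omega
    · simp only [hr, hi, not_false_eq_true, true_and, if_true]
      split_ifs <;> omega

theorem pairOfConfig_configOfPair (hq : IsSubPair q) (hne : q.1.Nonempty) :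
    pairOfConfig (configOfPair q) = q := by
  refine Prod.ext ?_ ?_
  · ext j
    rw [mem_pairOfConfig_fst, inChain_configOfPair_iff hne, not_not]
  · ext j
    rw [mem_pairOfConfig_snd, inChain_configOfPair_iff hne, not_not, configOfPair_rot]
    have := hq j
    by_cases h1 : j ∈ q.1 <;> by_cases h2 : j ∈ q.2 <;> by_cases h3 : rot m j ∈ q.1 <;>
      simp_all

/-- The subgraphs of the cycle with `v` vertices and `e` edges, as pairs of sets. -/
def subPairs (m v e : ℕ) : Set (Finset (Fin m) × Finset (Fin m)) :=
  {q | IsSubPair q ∧ q.1.card = v ∧ q.2.card = e}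

theorem nonempty_of_mem_subPairs {v e : ℕ} (he : 0 < e) (hq : q ∈ subPairs m v e) :
    q.1.Nonempty := by
  obtain ⟨h1, -, h2⟩ := hq
  obtain ⟨i, hi⟩ := Finset.card_pos.1 (h2.symm ▸ he)
  exact ⟨i, (h1 i hi).1⟩

theorem ncard_configs_eq (hm : 2 ≤ m) {v e : ℕ} (he : 0 < e) (hv : v ≤ m) :
    {c : Config (Fin m) | (c ∈ Stable (wheel m) ∧ EdgeBounded c) ∧ ∑ i, c i = m + e ∧
      weight01 c = m - v}.ncard = (subPairs m v e).ncard := by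
  symm
  refine Set.ncard_congr (fun q _ => configOfPair q) ?_ ?_ ?_
  · intro q hq
    have hne := nonempty_of_mem_subPairs he hq
    have hw := weight01_configOfPair hne
    obtain ⟨h1, h2, h3⟩ := hq
    refine ⟨⟨configOfPair_mem_stable hm, edgeBounded_configOfPair⟩, ?_, by omega⟩
    rw [sum_configOfPair h1, h3]
  · intro q q' hq hq' h
    rw [← pairOfConfig_configOfPair hq.1 (nonempty_of_mem_subPairs he hq), h,
      pairOfConfig_configOfPair hq'.1 (nonempty_of_mem_subPairs he hq')]
  · rintro c ⟨⟨h1, h2⟩, h3, h4⟩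
    have hsum : m < ∑ i, c i := by omega
    have hcc := configOfPair_pairOfConfig hm h1 h2 hsum
    have hs := sum_configOfPair (isSubPair_pairOfConfig c)
    have hw := weight01_configOfPair (pairOfConfig_fst_nonempty hsum)
    rw [hcc] at hs hw
    exact ⟨pairOfConfig c, ⟨isSubPair_pairOfConfig c, by omega, by omega⟩, hcc⟩

end Pairs

/-! ### Subgraphs as pairs of sets, and their components -/

section Subgraphs

variable {m : ℕ}

theorem cycle_isLink {e x y : Fin m} : (cycle m).IsLink e x y ↔ s(x, y) = s(e, rot m e) := Iff.rfl

theorem isLink_of_le_cycle {H : Graph (Fin m) (Fin m)} (hH : H ≤ cycle m) {e : Fin m}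
    (he : e ∈ H.edgeSet) : H.IsLink e e (rot m e) :=
  (hH.isLink_iff he).2 (cycle_isLink.2 rfl)

/-- The subgraph of the cycle with given vertex set and edge set. -/
def graphOfPair (q : Finset (Fin m) × Finset (Fin m)) (hq : IsSubPair q) :
    Graph (Fin m) (Fin m) where
  vertexSet := q.1
  IsLink e x y := e ∈ q.2 ∧ s(x, y) = s(e, rot m e)
  isLink_symm _ _ := ⟨fun _ _ h => ⟨h.1, Sym2.eq_swap.trans h.2⟩⟩
  eq_or_eq_of_isLink_of_isLink e x y v w h h' := by
    rcases Sym2.eq_iff.1 (h.2.trans h'.2.symm) with ⟨h1, _⟩ | ⟨h1, _⟩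
    · exact Or.inl h1
    · exact Or.inr h1
  left_mem_of_isLink e x y h := by
    rcases Sym2.eq_iff.1 h.2 with ⟨rfl, _⟩ | ⟨rfl, _⟩
    · exact (hq _ h.1).1
    · exact (hq _ h.1).2

theorem edgeSet_graphOfPair (q : Finset (Fin m) × Finset (Fin m)) (hq : IsSubPair q) :
    (graphOfPair q hq).edgeSet = q.2 := by
  ext e
  rw [Graph.edge_mem_iff_exists_isLink]
  exact ⟨fun ⟨_, _, h⟩ => h.1, fun h => ⟨e, rot m e, h, rfl⟩⟩

theorem graphOfPair_le (q : Finset (Fin m) × Finset (Fin m)) (hq : IsSubPair q) :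
    graphOfPair q hq ≤ cycle m :=
  ⟨Set.subset_univ _, fun _ _ _ h => h.2⟩

theorem ncard_subgraphs_eq {v e : ℕ} (he : 0 < e) :
    {H ∈ Sub (cycle m) | H.edgeSet.ncard = e ∧ H.vertexSet.ncard = v}.ncard =
      (subPairs m v e).ncard := by
  symm
  refine Set.ncard_congr (fun q hq => graphOfPair q hq.1) ?_ ?_ ?_
  · intro q hq
    refine ⟨⟨graphOfPair_le _ _, Finset.coe_nonempty.2 (nonempty_of_mem_subPairs he hq)⟩, ?_, ?_⟩
    · rw [edgeSet_graphOfPair, Set.ncard_coe_finset, hq.2.2]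
    · exact (Set.ncard_coe_finset _).trans hq.2.1
  · intro q q' hq hq' h
    refine Prod.ext (Finset.coe_injective ?_) (Finset.coe_injective ?_)
    · exact congrArg Graph.vertexSet h
    · rw [← edgeSet_graphOfPair q hq.1, ← edgeSet_graphOfPair q' hq'.1, h]
  · rintro H ⟨⟨hle, -⟩, h1, h2⟩
    have hq : IsSubPair (H.vertexSet.toFinite.toFinset, H.edgeSet.toFinite.toFinset) := by
      intro i hi
      have := isLink_of_le_cycle hle ((Set.Finite.mem_toFinset _).1 hi)
      exact ⟨(Set.Finite.mem_toFinset _).2 this.left_mem,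
        (Set.Finite.mem_toFinset _).2 this.right_mem⟩
    refine ⟨_, ⟨hq, ?_, ?_⟩, ?_⟩
    · rw [← Set.ncard_eq_toFinset_card, h2]
    · rw [← Set.ncard_eq_toFinset_card, h1]
    · refine Graph.Compatible.ext ?_ ?_ (Graph.Compatible.of_le_le (graphOfPair_le _ _) hle)
      · exact Set.Finite.coe_toFinset _
      · rw [edgeSet_graphOfPair]
        exact Set.Finite.coe_toFinset _

theorem exists_shift_notMem {F : Set (Fin m)} (hF : F ≠ Set.univ) (i : Fin m) :
    ∃ l, shift i l ∉ F := by
  obtain ⟨j, hj⟩ := (Set.ne_univ_iff_exists_notMem F).1 hF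
  obtain ⟨l, -, rfl⟩ := exists_shift_eq i j
  exact ⟨l, hj⟩

open Classical in
/-- The last vertex, clockwise, of the component of `i` in a subgraph of the cycle with edge
set `F`. -/
def lastVertex {F : Set (Fin m)} (hF : F ≠ Set.univ) (i : Fin m) : Fin m :=
  shift i (Nat.find (exists_shift_notMem hF i))

variable {F : Set (Fin m)} (hF : F ≠ Set.univ)

theorem lastVertex_notMem (i : Fin m) : lastVertex hF i ∉ F := by
  classical exact Nat.find_spec (exists_shift_notMem hF i)

theorem lastVertex_of_notMem {i : Fin m} (hi : i ∉ F) : lastVertex hF i = i := by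
  classical
  have : Nat.find (exists_shift_notMem hF i) = 0 :=
    (Nat.find_eq_zero _).2 (by rwa [shift_zero])
  rw [lastVertex, this, shift_zero]

theorem lastVertex_rot {i : Fin m} (hi : i ∈ F) : lastVertex hF (rot m i) = lastVertex hF i := by
  classical
  have h0 : ¬ shift i 0 ∉ F := by rwa [shift_zero, not_not]
  have h1 : ∃ l, shift i (l + 1) ∉ F := by
    obtain ⟨l, hl⟩ := exists_shift_notMem hF (rot m i)
    exact ⟨l, by rwa [← shift_rot]⟩
  rw [lastVertex, lastVertex, Nat.find_comp_succ (exists_shift_notMem hF i) h1 h0,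
    ← shift_rot]
  congr 2
  simp only [shift_rot]

/-- With an edge missing, every component is an arc. Its last vertex is the only one whose outgoing
edge is absent, so components correspond to vertices outside the edge set, edges being identified
with their first ends. -/
theorem numComponents_add_ncard {H : Graph (Fin m) (Fin m)} (hH : H ≤ cycle m)
    (hE : H.edgeSet ≠ Set.univ) :
    numComponents H + H.edgeSet.ncard = H.vertexSet.ncard := by
  have hsub : H.edgeSet ⊆ H.vertexSet := fun e he => (isLink_of_le_cycle hH he).left_mem
  have hreach : ∀ (l : ℕ) (i : H.vertexSet), (∀ k < l, shift i.1 k ∈ H.edgeSet) →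
      ∃ h : shift i.1 l ∈ H.vertexSet,
        Quot.mk (fun x y : H.vertexSet => H.Adj x y) ⟨_, h⟩ = Quot.mk _ i := by
    intro l
    induction l with
    | zero =>
      intro i _
      exact ⟨by rw [shift_zero]; exact i.2, by simp only [shift_zero]⟩
    | succ l ih =>
      intro i hi
      obtain ⟨h1, h2⟩ := ih i fun k hk => hi k (hk.trans l.lt_succ_self)
      have h3 := isLink_of_le_cycle hH (hi l l.lt_succ_self)
      rw [← shift_succ] at h3
      exact ⟨h3.right_mem, (Quot.sound (r := fun x y : H.vertexSet => H.Adj x y)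
        (a := ⟨_, h3.right_mem⟩) (b := ⟨_, h1⟩) h3.symm.adj).trans h2⟩
  have hlast : ∀ i : H.vertexSet, ∃ h : lastVertex hE i.1 ∈ H.vertexSet,
      Quot.mk (fun x y : H.vertexSet => H.Adj x y) ⟨_, h⟩ = Quot.mk _ i := by
    classical
    intro i
    exact hreach _ i fun k hk => not_not.1 (Nat.find_min (exists_shift_notMem hE i.1) hk)
  let e : Quot (fun x y : H.vertexSet => H.Adj x y) ≃ ↥(H.vertexSet \ H.edgeSet) :=
    { toFun := Quot.lift (fun i => ⟨lastVertex hE i.1, (hlast i).1, lastVertex_notMem hE _⟩) (by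
        rintro ⟨x, hx⟩ ⟨y, hy⟩ ⟨e, he⟩
        refine Subtype.ext ?_
        rcases Sym2.eq_iff.1 (cycle_isLink.1 (he.mono hH)) with ⟨rfl, rfl⟩ | ⟨rfl, rfl⟩
        · exact (lastVertex_rot hE he.edge_mem).symm
        · exact lastVertex_rot hE he.edge_mem)
      invFun j := Quot.mk _ ⟨j.1, j.2.1⟩
      left_inv := by
        rintro ⟨i⟩
        exact (hlast i).2
      right_inv j := Subtype.ext (lastVertex_of_notMem hE j.2.2) }
  rw [numComponents, Nat.card_congr e, Nat.card_coe_set_eq]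
  exact Set.ncard_sdiff_add_ncard_of_subset hsub

end Subgraphs

/-! ### Counting words without the factor `UD` -/

section Words

/-- The words with `r` letters `R`, `u` letters `U` and `d` letters `D`. -/
def stepWords (r u d : ℕ) : Set (List Step) :=
  {w | w.count Step.R = r ∧ w.count Step.U = u ∧ w.count Step.D = d}

/-- Splitting by first letter; `encard` makes the recursions valid without separate finiteness
proofs. -/
theorem encard_words_eq (P : Set (List Step)) : P.encard = (P ∩ {[]}).encard +
    ({w | Step.R :: w ∈ P}.encard + ({w | Step.U :: w ∈ P}.encard +
      {w | Step.D :: w ∈ P}.encard)) := by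
  have h : P = (P ∩ {[]}) ∪ ((Step.R :: ·) '' {w | Step.R :: w ∈ P} ∪
      ((Step.U :: ·) '' {w | Step.U :: w ∈ P} ∪ (Step.D :: ·) '' {w | Step.D :: w ∈ P})) := by
    ext w
    rcases w with _ | ⟨x, w⟩
    · simp
    · cases x <;> simp
  conv_lhs => rw [h]
  rw [Set.encard_union_eq, Set.encard_union_eq, Set.encard_union_eq,
    (List.cons_injective).encard_image, (List.cons_injective).encard_image,
    (List.cons_injective).encard_image]
  all_goals
    rw [Set.disjoint_left]
    rintro w h1 h2
    simp at h1 h2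
    grind

theorem encard_setOf_and {α : Type*} (p : Prop) [Decidable p] (s : Set α) :
    {w | p ∧ w ∈ s}.encard = if p then s.encard else 0 := by
  split_ifs with h <;> simp [h]

theorem cons_R_mem_stepWords {r u d : ℕ} {w : List Step} :
    Step.R :: w ∈ stepWords r u d ↔ r ≠ 0 ∧ w ∈ stepWords (r - 1) u d := by
  change (Step.R :: w).count Step.R = r ∧ (Step.R :: w).count Step.U = u ∧
    (Step.R :: w).count Step.D = d ↔ r ≠ 0 ∧ w.count Step.R = r - 1 ∧ w.count Step.U = u ∧
      w.count Step.D = d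
  simp only [List.count_cons, beq_iff_eq, reduceCtorEq, if_true, if_false]
  omega

theorem cons_U_mem_stepWords {r u d : ℕ} {w : List Step} :
    Step.U :: w ∈ stepWords r u d ↔ u ≠ 0 ∧ w ∈ stepWords r (u - 1) d := by
  change (Step.U :: w).count Step.R = r ∧ (Step.U :: w).count Step.U = u ∧
    (Step.U :: w).count Step.D = d ↔ u ≠ 0 ∧ w.count Step.R = r ∧ w.count Step.U = u - 1 ∧
      w.count Step.D = d
  simp only [List.count_cons, beq_iff_eq, reduceCtorEq, if_true, if_false]
  omega

theorem cons_D_mem_stepWords {r u d : ℕ} {w : List Step} :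
    Step.D :: w ∈ stepWords r u d ↔ d ≠ 0 ∧ w ∈ stepWords r u (d - 1) := by
  change (Step.D :: w).count Step.R = r ∧ (Step.D :: w).count Step.U = u ∧
    (Step.D :: w).count Step.D = d ↔ d ≠ 0 ∧ w.count Step.R = r ∧ w.count Step.U = u ∧
      w.count Step.D = d - 1
  simp only [List.count_cons, beq_iff_eq, reduceCtorEq, if_true, if_false]
  omega

theorem nil_mem_stepWords {r u d : ℕ} : [] ∈ stepWords r u d ↔ r = 0 ∧ u = 0 ∧ d = 0 := by
  simp [stepWords, eq_comm]

theorem encard_inter_nil (P : Set (List Step)) (p : Prop) [Decidable p] (h : [] ∈ P ↔ p) :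
    (P ∩ {[]}).encard = if p then 1 else 0 := by
  split_ifs with hp
  · rw [Set.inter_eq_right.2 (Set.singleton_subset_iff.2 (h.2 hp)), Set.encard_singleton]
  · rw [Set.inter_singleton_eq_empty.2 (mt h.1 hp), Set.encard_empty]

theorem choose_mul_choose_rec (r u d : ℕ) :
    (r + u).choose r * (r + u + d).choose d = (if r = 0 ∧ u = 0 ∧ d = 0 then 1 else 0) +
      ((if r ≠ 0 then (r - 1 + u).choose (r - 1) * (r - 1 + u + d).choose d else 0) +
        ((if u ≠ 0 then (r + (u - 1)).choose r * (r + (u - 1) + d).choose d else 0) +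
          (if d ≠ 0 then (r + u).choose r * (r + u + (d - 1)).choose (d - 1) else 0))) := by
  have pas : ∀ a b : ℕ, (a + 1 + (b + 1)).choose (a + 1) =
      (a + (b + 1)).choose a + (a + 1 + b).choose (a + 1) := by
    intro a b
    rw [show a + 1 + (b + 1) = (a + 1 + b) + 1 by ring, Nat.choose_succ_succ,
      show a + (b + 1) = a + 1 + b by ring]
  have pas' : ∀ N b : ℕ, (N + (b + 1)).choose (b + 1) =
      (N + b).choose b + (N + b).choose (b + 1) := fun N b => Nat.choose_succ_succ _ _
  rcases r with _ | r <;> rcases u with _ | u <;> rcases d with _ | d <;> simp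
  · rw [pas' (u + 1) d, show u + (d + 1) = u + 1 + d by ring]; ring
  · rw [pas' (r + 1) d, show r + (d + 1) = r + 1 + d by ring]; ring
  · rw [pas]
  · rw [pas, pas' (r + 1 + (u + 1)) d, show r + (u + 1) + (d + 1) = r + 1 + (u + 1) + d by ring,
      show r + 1 + u + (d + 1) = r + 1 + (u + 1) + d by ring]
    ring

theorem encard_stepWords (r u d : ℕ) :
    (stepWords r u d).encard = (((r + u).choose r * (r + u + d).choose d : ℕ) : ℕ∞) := by
  induction hN : r + u + d using Nat.strong_induction_on generalizing r u d with
  | _ N ih =>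
    subst hN
    rw [encard_words_eq, encard_inter_nil _ _ nil_mem_stepWords, choose_mul_choose_rec]
    simp only [cons_R_mem_stepWords, cons_U_mem_stepWords, cons_D_mem_stepWords, encard_setOf_and]
    push_cast
    congr 1
    · congr 1
      · split_ifs with h
        · exact_mod_cast ih _ (by omega) _ _ _ rfl
        · rfl
      · congr 1 <;>
        · split_ifs with h
          · exact_mod_cast ih _ (by omega) _ _ _ rfl
          · rfl

/-- The words with `r` letters `R`, `u` letters `U` and `d` letters `D` in which no `U` is
immediately followed by a `D`. -/
def chainWords (r u d : ℕ) : Set (List Step) :=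
  {w | w ∈ stepWords r u d ∧ w.IsChain fun x y => ¬ (x = Step.U ∧ y = Step.D)}

/-- The words of `chainWords r u d` that do not begin with `D`. -/
def startWords (r u d : ℕ) : Set (List Step) :=
  {w | w ∈ chainWords r u d ∧ w.head? ≠ some Step.D}

theorem cons_R_mem_chainWords {r u d : ℕ} {w : List Step} :
    Step.R :: w ∈ chainWords r u d ↔ r ≠ 0 ∧ w ∈ chainWords (r - 1) u d := by
  change Step.R :: w ∈ stepWords r u d ∧ (Step.R :: w).IsChain _ ↔
    r ≠ 0 ∧ w ∈ stepWords (r - 1) u d ∧ w.IsChain _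
  rw [cons_R_mem_stepWords, List.isChain_cons]
  simp [and_assoc]

theorem cons_D_mem_chainWords {r u d : ℕ} {w : List Step} :
    Step.D :: w ∈ chainWords r u d ↔ d ≠ 0 ∧ w ∈ chainWords r u (d - 1) := by
  change Step.D :: w ∈ stepWords r u d ∧ (Step.D :: w).IsChain _ ↔
    d ≠ 0 ∧ w ∈ stepWords r u (d - 1) ∧ w.IsChain _
  rw [cons_D_mem_stepWords, List.isChain_cons]
  simp [and_assoc]

theorem cons_U_mem_chainWords {r u d : ℕ} {w : List Step} :
    Step.U :: w ∈ chainWords r u d ↔ u ≠ 0 ∧ w ∈ startWords r (u - 1) d := by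
  change Step.U :: w ∈ stepWords r u d ∧ (Step.U :: w).IsChain _ ↔
    u ≠ 0 ∧ (w ∈ stepWords r (u - 1) d ∧ w.IsChain _) ∧ w.head? ≠ some Step.D
  rw [cons_U_mem_stepWords, List.isChain_cons]
  have : (∀ y ∈ w.head?, ¬ (Step.U = Step.U ∧ y = Step.D)) ↔ w.head? ≠ some Step.D := by
    constructor
    · intro h h'
      exact h _ h' ⟨rfl, rfl⟩
    · rintro h y hy ⟨-, rfl⟩
      exact h hy
  rw [this]
  tauto

theorem nil_mem_chainWords {r u d : ℕ} : [] ∈ chainWords r u d ↔ r = 0 ∧ u = 0 ∧ d = 0 := by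
  rw [← nil_mem_stepWords]
  exact and_iff_left List.isChain_nil

theorem encard_startWords_rec (r u d : ℕ) : (startWords r u d).encard =
    (if r = 0 ∧ u = 0 ∧ d = 0 then 1 else 0) +
      ((if r ≠ 0 then (chainWords (r - 1) u d).encard else 0) +
        (if u ≠ 0 then (startWords r (u - 1) d).encard else 0)) := by
  have hn : [] ∈ startWords r u d ↔ r = 0 ∧ u = 0 ∧ d = 0 := by
    rw [← nil_mem_chainWords]
    exact and_iff_left (by simp)
  have hR : ∀ w, Step.R :: w ∈ startWords r u d ↔ r ≠ 0 ∧ w ∈ chainWords (r - 1) u d := fun w => by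
    rw [← cons_R_mem_chainWords]
    exact and_iff_left (by simp)
  have hU : ∀ w, Step.U :: w ∈ startWords r u d ↔ u ≠ 0 ∧ w ∈ startWords r (u - 1) d := fun w => by
    rw [← cons_U_mem_chainWords]
    exact and_iff_left (by simp)
  have hD : ∀ w, ¬ Step.D :: w ∈ startWords r u d := fun w h => h.2 (by simp)
  rw [encard_words_eq, encard_inter_nil _ _ hn]
  simp only [hR, hU, hD, encard_setOf_and]
  simp

/-- Any admissible word may follow an initial `D`. -/
theorem encard_chainWords_rec (r u d : ℕ) : (chainWords r u d).encard =
    (startWords r u d).encard + (if d ≠ 0 then (chainWords r u (d - 1)).encard else 0) := by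
  rw [encard_words_eq, encard_inter_nil _ _ nil_mem_chainWords, encard_startWords_rec]
  simp only [cons_R_mem_chainWords, cons_U_mem_chainWords, cons_D_mem_chainWords, encard_setOf_and]
  ring

/-- The letters `R` cut a word into `r + 1` blocks of the form `D…DU…U`, so the `D`s and the `U`s
are distributed independently over the blocks. If `D` may not come first, only `r` blocks can
receive a `D`. -/
theorem encard_chainWords_startWords (r u d : ℕ) :
    (startWords r u d).encard = (((d + r - 1).choose d * (u + r).choose r : ℕ) : ℕ∞) ∧
    (chainWords r u d).encard = (((d + r).choose d * (u + r).choose r : ℕ) : ℕ∞) := by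
  induction hN : r + u + d using Nat.strong_induction_on generalizing r u d with
  | _ N ih =>
    subst hN
    have h1 : (startWords r u d).encard =
        (((d + r - 1).choose d * (u + r).choose r : ℕ) : ℕ∞) := by
      rw [encard_startWords_rec]
      rcases r with _ | r <;> rcases u with _ | u
      -- For `r = 0` the truncated `(d - 1).choose d` is 1 if `d = 0` and 0 otherwise, as required.
      · rcases d with _ | d <;> simp
      · have := (ih (0 + u + d) (by omega) 0 u d rfl).1
        simp only [Nat.add_sub_cancel, this]
        rcases d with _ | d <;> simp
      · have := (ih (r + 0 + d) (by omega) r 0 d rfl).2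
        simp [this]
      · have e1 := (ih (r + (u + 1) + d) (by omega) r (u + 1) d rfl).2
        have e2 := (ih (r + 1 + u + d) (by omega) (r + 1) u d rfl).1
        simp only [Nat.add_sub_cancel, e1, e2, ← Nat.add_assoc]
        rw [show u + 1 + r = u + r + 1 by ring, Nat.choose_succ_succ' (u + r + 1) r]
        simp
        ring
    refine ⟨h1, ?_⟩
    rw [encard_chainWords_rec, h1]
    rcases d with _ | d
    · simp
    · have e := (ih (r + u + d) (by omega) r u d rfl).2
      simp only [Nat.add_sub_cancel, e]
      rw [show d + 1 + r - 1 = d + r by omega, show d + 1 + r = d + r + 1 by ring,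
        Nat.choose_succ_succ]
      simp
      ring

/-- The words of `chainWords r u d` whose last and first letters are not `U` and `D`. -/
def cyclicWords (r u d : ℕ) : Set (List Step) :=
  {w | w ∈ chainWords r u d ∧ ¬ (w.getLast? = some Step.U ∧ w.head? = some Step.D)}

/-- The excluded words are `D w U` with `w` admissible: neither the leading `D` nor the trailing `U`
can create a factor `UD`. -/
theorem encard_cyclicWords_add (r u d : ℕ) : (cyclicWords r u d).encard +
    (if d ≠ 0 ∧ u ≠ 0 then (chainWords r (u - 1) (d - 1)).encard else 0) =
      (chainWords r u d).encard := by
  have h : {w | w ∈ chainWords r u d ∧ w.getLast? = some Step.U ∧ w.head? = some Step.D} =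
      (fun w => Step.D :: (w ++ [Step.U])) ''
        {w | (d ≠ 0 ∧ u ≠ 0) ∧ w ∈ chainWords r (u - 1) (d - 1)} := by
    have hmem : ∀ w : List Step, Step.D :: (w ++ [Step.U]) ∈ chainWords r u d ↔
        (d ≠ 0 ∧ u ≠ 0) ∧ w ∈ chainWords r (u - 1) (d - 1) := by
      intro w
      rw [cons_D_mem_chainWords, and_assoc]
      refine and_congr_right fun _ => ?_
      have hc : (w ++ [Step.U]).IsChain (fun x y => ¬ (x = Step.U ∧ y = Step.D)) ↔
          w.IsChain (fun x y => ¬ (x = Step.U ∧ y = Step.D)) := by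
        rw [List.isChain_append]
        simp
      change (((w ++ [Step.U]).count Step.R = r ∧ (w ++ [Step.U]).count Step.U = u ∧
        (w ++ [Step.U]).count Step.D = d - 1) ∧ (w ++ [Step.U]).IsChain _) ↔
        u ≠ 0 ∧ ((w.count Step.R = r ∧ w.count Step.U = u - 1 ∧ w.count Step.D = d - 1) ∧
          w.IsChain _)
      rw [hc]
      simp only [List.count_append, List.count_singleton, beq_iff_eq, reduceCtorEq, if_true,
        if_false]
      constructor
      · rintro ⟨⟨h1, h2, h3⟩, h4⟩
        exact ⟨by omega, ⟨by omega, by omega, by omega⟩, h4⟩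
      · rintro ⟨h0, ⟨h1, h2, h3⟩, h4⟩
        exact ⟨⟨by omega, by omega, by omega⟩, h4⟩
    ext w
    constructor
    · rintro ⟨hw, hl, hh⟩
      obtain ⟨v, rfl⟩ := List.getLast?_eq_some_iff.1 hl
      rcases v with _ | ⟨x, v⟩
      · simp at hh
      · have : x = Step.D := by simpa using hh
        subst this
        exact ⟨v, (hmem v).1 hw, rfl⟩
    · rintro ⟨v, hv, rfl⟩
      exact ⟨(hmem v).2 hv, by simp [List.getLast?_cons], by simp⟩
  have hinj : Function.Injective fun w : List Step => Step.D :: (w ++ [Step.U]) :=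
    fun a b hab => by simpa using hab
  rw [← encard_setOf_and, ← hinj.encard_image {w | (d ≠ 0 ∧ u ≠ 0) ∧ _}, ← h, ← Set.encard_union_eq]
  · congr 1
    ext w
    change (_ ∧ ¬ _) ∨ (_ ∧ _) ↔ _
    tauto
  · rw [Set.disjoint_left]
    exact fun w h1 h2 => h1.2 h2.2

end Words

/-! ### Subgraphs as cyclic words -/

section PairWords

variable {m : ℕ}

/-- The word that describes a subgraph of the cycle, vertex by vertex: `D` for a missing vertex, `U`
for a vertex joined to the next one, `R` for the last vertex of a component. -/
def wordOfPair (q : Finset (Fin m) × Finset (Fin m)) : List Step :=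
  List.ofFn fun i => if i ∈ q.1 then (if i ∈ q.2 then Step.U else Step.R) else Step.D

theorem count_ofFn_eq_card (s : Fin m → Step) (x : Step) :
    (List.ofFn s).count x = (Finset.univ.filter fun i => s i = x).card := by
  rw [Finset.card_filter]
  induction m with
  | zero => simp
  | succ m ih =>
    rw [List.ofFn_succ, List.count_cons, ih, Fin.sum_univ_succ, add_comm]
    simp

theorem forall_rot_iff (s : Fin m → Step) :
    (∀ i, ¬ (s i = Step.U ∧ s (rot m i) = Step.D)) ↔
      (List.ofFn s).IsChain (fun x y => ¬ (x = Step.U ∧ y = Step.D)) ∧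
        ¬ ((List.ofFn s).getLast? = some Step.U ∧ (List.ofFn s).head? = some Step.D) := by
  rcases m with _ | m
  · simp
  rw [List.isChain_ofFn, List.getLast?_eq_some_getLast (by simp), List.getLast_ofFn_succ]
  have hlast : rot (m + 1) (Fin.last m) = 0 := by
    ext; simp [rot, shift]
  have hrot : ∀ (i : ℕ) (hi : i + 1 < m + 1), rot (m + 1) ⟨i, Nat.lt_of_succ_lt hi⟩ = ⟨i + 1, hi⟩ :=
    fun i hi => by ext; simp [rot, shift, Nat.mod_eq_of_lt hi]
  simp only [List.ofFn_succ, List.head?_cons, Option.some.injEq]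
  constructor
  · intro h
    refine ⟨fun i hi => ?_, ?_⟩
    · rw [← hrot i hi]
      exact h _
    · have := h (Fin.last m)
      rwa [hlast] at this
  · rintro ⟨h1, h2⟩ i
    rcases Nat.lt_or_ge (i.val + 1) (m + 1) with hi | hi
    · have := h1 i.val hi
      rw [← hrot i.val hi] at this
      exact this
    · have : i = Fin.last m := by
        ext
        have := i.isLt
        simp only [Fin.val_last]
        omega
      rw [this, hlast]
      exact h2

/-- A vertex joined to the next one forces that vertex to be present; this is the only constraint,
and it says that `UD` does not occur cyclically. -/
theorem ncard_subPairs_eq {r u d : ℕ} (hm : r + u + d = m) :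
    (subPairs m (r + u) u).ncard = (cyclicWords r u d).ncard := by
  refine Set.ncard_congr (fun q _ => wordOfPair q) ?_ ?_ ?_
  · rintro ⟨A, F⟩ ⟨h1, h2, h3⟩
    replace h1 : ∀ i ∈ F, i ∈ A ∧ rot m i ∈ A := h1
    simp only at h2 h3
    have hFA : F ⊆ A := fun i hi => (h1 i hi).1
    refine ⟨⟨⟨?_, ?_, ?_⟩, ?_⟩, ?_⟩
    · rw [wordOfPair, count_ofFn_eq_card]
      have : (Finset.univ.filter fun i => (if i ∈ A then (if i ∈ F then Step.U else Step.R)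
          else Step.D) = Step.R) = A \ F := by
        ext i
        simp only [Finset.mem_filter, Finset.mem_univ, true_and, Finset.mem_sdiff]
        split_ifs <;> simp_all
      rw [this, Finset.card_sdiff_of_subset hFA]
      omega
    · rw [wordOfPair, count_ofFn_eq_card, ← h3]
      congr 1
      ext i
      have := @hFA i
      simp only [Finset.mem_filter, Finset.mem_univ, true_and]
      split_ifs <;> simp_all
      tauto
    · rw [wordOfPair, count_ofFn_eq_card]
      have : (Finset.univ.filter fun i => (if i ∈ A then (if i ∈ F then Step.U else Step.R)
          else Step.D) = Step.D) = Aᶜ := by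
        ext i
        simp only [Finset.mem_filter, Finset.mem_univ, true_and, Finset.mem_compl]
        split_ifs <;> simp_all
      rw [this, Finset.card_compl, Fintype.card_fin]
      omega
    all_goals
      have h4 := (forall_rot_iff fun i => if i ∈ A then (if i ∈ F then Step.U else Step.R)
        else Step.D).1 fun i => by
          have := h1 i
          split_ifs <;> simp_all
    · exact h4.1
    · exact h4.2
  · rintro ⟨A, F⟩ ⟨A', F'⟩ ⟨h1, -⟩ ⟨h1', -⟩ h
    replace h1 : ∀ i ∈ F, i ∈ A ∧ rot m i ∈ A := h1
    replace h1' : ∀ i ∈ F', i ∈ A' ∧ rot m i ∈ A' := h1'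
    have h2 := List.ofFn_injective h
    have hA : A = A' := by
      ext i
      have := congrFun h2 i
      simp only at this
      split_ifs at this <;> simp_all
    have hF : F = F' := by
      ext i
      have := congrFun h2 i
      have h3 := h1 i
      have h3' := h1' i
      simp only at this
      split_ifs at this <;> simp_all
      exact fun hi => absurd (h1' i hi).1 (by assumption)
    rw [hA, hF]
  · rintro w ⟨⟨⟨h1, h2, h3⟩, h4⟩, h5⟩
    have hlen : w.length = m := by
      have : ∀ v : List Step, v.length =
          v.count Step.R + v.count Step.U + v.count Step.D := by
        intro v
        induction v with
        | nil => rfl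
        | cons x v ih => cases x <;> simp [ih] <;> omega
      rw [this, h1, h2, h3, hm]
    obtain ⟨s, rfl⟩ : ∃ s : Fin m → Step, w = List.ofFn s := by
      subst hlen
      exact ⟨w.get, (List.ofFn_get w).symm⟩
    have h6 := (forall_rot_iff s).2 ⟨h4, h5⟩
    rw [count_ofFn_eq_card] at h1 h2 h3
    have hw : wordOfPair (Finset.univ.filter fun i => s i ≠ Step.D,
        Finset.univ.filter fun i => s i = Step.U) = List.ofFn s := by
      rw [wordOfPair]
      congr 1
      ext i
      simp only [Finset.mem_filter, Finset.mem_univ, true_and]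
      cases s i <;> simp
    have hc := Finset.card_filter_add_card_filter_not (s := (Finset.univ : Finset (Fin m)))
      fun i => s i = Step.D
    rw [Finset.card_univ, Fintype.card_fin] at hc
    refine ⟨_, ⟨?_, ?_, h2⟩, hw⟩
    · intro i hi
      have hi' : s i = Step.U := by simpa using hi
      have := h6 i
      simp_all
    · simp only [ne_eq]
      omega

/-- For `k = n` the correction vanishes; otherwise it is a factorial identity, checked over `ℚ` with
`k = j + 1` and `n = k + b + 1`. -/
theorem choose_identity (n k : ℕ) (hk : 1 ≤ k) (hkn : k ≤ n) :
    (2 * k).choose k * (n + k - 1).choose (n - k) +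
      (if n - k ≠ 0 ∧ n ≠ 0 then
        (n - k - 1 + k).choose (n - k - 1) * (n - 1 + k).choose k else 0) =
      (n - k + k).choose (n - k) * (n + k).choose k := by
  obtain ⟨a, rfl⟩ := Nat.exists_eq_add_of_le hkn
  obtain ⟨j, rfl⟩ := Nat.exists_eq_add_of_le hk
  rcases a with _ | b
  · simp [two_mul]
  · rw [show 1 + j + (b + 1) - (1 + j) = b + 1 by omega,
      show 1 + j + (b + 1) + (1 + j) - 1 = b + 1 + (2 * j + 1) by omega,
      if_pos ⟨by omega, by omega⟩, Nat.add_sub_cancel,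
      show 1 + j + (b + 1) - 1 + (1 + j) = (j + 1) + (j + b + 1) by omega,
      show b + (1 + j) = b + (j + 1) by omega, show b + 1 + (1 + j) = b + 1 + (j + 1) by omega,
      show 1 + j + (b + 1) + (1 + j) = (j + 1) + (j + b + 2) by omega,
      show 2 * (1 + j) = (j + 1) + (j + 1) by omega, show 1 + j = j + 1 by omega]
    have key : ((((j + 1) + (j + 1)).choose (j + 1) * (b + 1 + (2 * j + 1)).choose (b + 1) +
        (b + (j + 1)).choose b * ((j + 1) + (j + b + 1)).choose (j + 1) : ℕ) : ℚ) =
        (((b + 1 + (j + 1)).choose (b + 1) * ((j + 1) + (j + b + 2)).choose (j + 1) : ℕ) : ℚ) := by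
      push_cast [Nat.cast_add_choose]
      rw [show j + 1 + (j + 1) = 2 * j + 1 + 1 by ring,
        show b + 1 + (2 * j + 1) = 2 * j + b + 1 + 1 by ring,
        show j + 1 + (j + b + 1) = 2 * j + b + 1 + 1 by ring,
        show b + (j + 1) = j + b + 1 by ring,
        show b + 1 + (j + 1) = j + b + 1 + 1 by ring,
        show j + 1 + (j + b + 2) = 2 * j + b + 1 + 1 + 1 by ring,
        show j + b + 2 = j + b + 1 + 1 by ring]
      rw [Nat.factorial_succ (2 * j + 1), Nat.factorial_succ (2 * j + b + 1 + 1),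
        Nat.factorial_succ b]
      have h1 : ((j + b + 1).factorial : ℚ) ≠ 0 := by exact_mod_cast Nat.factorial_ne_zero _
      have h2 : ((j + b + 1 + 1).factorial : ℚ) ≠ 0 := by exact_mod_cast Nat.factorial_ne_zero _
      have h3 : ((j + 1).factorial : ℚ) ≠ 0 := by exact_mod_cast Nat.factorial_ne_zero _
      have h4 : ((2 * j + 1).factorial : ℚ) ≠ 0 := by exact_mod_cast Nat.factorial_ne_zero _
      have h5 : (b.factorial : ℚ) ≠ 0 := by exact_mod_cast Nat.factorial_ne_zero _
      have h6 : (b + 1 : ℚ) ≠ 0 := by positivity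
      push_cast
      field_simp
      ring
    exact_mod_cast key

theorem ncard_subPairs {n k : ℕ} (hk : 1 ≤ k) (hkn : k ≤ n) :
    (subPairs (2 * n) (n + k) n).ncard = (2 * k).choose k * (n + k - 1).choose (n - k) := by
  rw [Nat.add_comm n k, ncard_subPairs_eq (d := n - k) (by omega), Nat.add_comm k n]
  have h1 := encard_cyclicWords_add k n (n - k)
  rw [(encard_chainWords_startWords k n (n - k)).2,
    (encard_chainWords_startWords k (n - 1) (n - k - 1)).2, ← choose_identity n k hk hkn] at h1
  have h2 : (cyclicWords k n (n - k)).encard =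
      (((2 * k).choose k * (n + k - 1).choose (n - k) : ℕ) : ℕ∞) := by
    push_cast at h1 ⊢
    -- Cancelling the correction term in `ℕ∞` requires it to be finite.
    refine ENat.add_left_injective_of_ne_top ?_ h1
    split_ifs
    · exact_mod_cast ENat.natCast_ne_top _
    · simp
  rw [Set.ncard_def, h2, ENat.toNat_natCast]

end PairWords

/-! ### Differed Delannoy paths -/

section Delannoy

theorem mem_diffDel_iff {n : ℕ} {w : List Step} : w ∈ DiffDel n ↔
    (w.count Step.R + w.count Step.D = n ∧ w.count Step.U + w.count Step.D = n) ∧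
      w.head? ≠ some Step.D := by
  have h : ∀ v : List Step, (v.map Step.vec).sum = (((v.count Step.R + v.count Step.D : ℕ) : ℤ),
      ((v.count Step.U + v.count Step.D : ℕ) : ℤ)) := by
    intro v
    induction v with
    | nil => rfl
    | cons x v ih =>
      rw [List.map_cons, List.sum_cons, ih]
      cases x <;> simp [Step.vec] <;> (try constructor) <;> ring
  refine and_congr_left fun _ => ?_
  rw [h, Prod.mk.injEq, Nat.cast_inj, Nat.cast_inj]

theorem ncard_diffDel {n k : ℕ} (hk : 1 ≤ k) (hkn : k ≤ n) :
    {w ∈ DiffDel n | w.count Step.R = k}.ncard =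
      (2 * k).choose k * (n + k - 1).choose (n - k) := by
  have hset : {w ∈ DiffDel n | w.count Step.R = k} =
      {w | w ∈ stepWords k k (n - k) ∧ w.head? ≠ some Step.D} := by
    ext w
    change w ∈ DiffDel n ∧ w.count Step.R = k ↔
      (w.count Step.R = k ∧ w.count Step.U = k ∧ w.count Step.D = n - k) ∧ w.head? ≠ some Step.D
    rw [mem_diffDel_iff]
    constructor
    · rintro ⟨⟨⟨h1, h2⟩, h3⟩, h4⟩
      exact ⟨⟨h4, by omega, by omega⟩, h3⟩
    · rintro ⟨⟨h1, h2, h3⟩, h4⟩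
      exact ⟨⟨⟨by omega, by omega⟩, h4⟩, h1⟩
  obtain ⟨j, rfl⟩ := Nat.exists_eq_add_of_le' hk
  have hn : [] ∈ {w | w ∈ stepWords (j + 1) (j + 1) (n - (j + 1)) ∧ w.head? ≠ some Step.D} ↔
      False := by
    refine ⟨fun h => ?_, False.elim⟩
    have := (nil_mem_stepWords.1 h.1).1
    omega
  have hsub : {w | w ∈ stepWords (j + 1) (j + 1) (n - (j + 1)) ∧ w.head? ≠ some Step.D}.encard =
      (stepWords j (j + 1) (n - (j + 1))).encard + (stepWords (j + 1) j (n - (j + 1))).encard := by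
    rw [encard_words_eq, encard_inter_nil _ False hn]
    simp [cons_R_mem_stepWords, cons_U_mem_stepWords]
  -- Deleting the first step, `R` or `U`, leaves two equal counts `(2j+1).choose j` and
  -- `(2j+1).choose (j+1)` with a common factor; Pascal's rule adds them.
  rw [hset, Set.ncard_def, hsub, encard_stepWords, encard_stepWords, ← Nat.cast_add,
    ENat.toNat_natCast, show 2 * (j + 1) = (j + j + 1) + 1 by ring, Nat.choose_succ_succ',
    show n + (j + 1) - 1 = j + j + 1 + (n - (j + 1)) by omega,
    show j + (j + 1) = j + j + 1 by ring, show j + 1 + j = j + j + 1 by ring]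
  ring

end Delannoy

end Sandpile

end

theorem theorem4p3 (n k : ℕ) (hn : 1 ≤ n) (hk : 1 ≤ k) (hkn : k ≤ n)
    (μ : PMF (Fin (2 * n))) (hμ : ∀ i, 0 < μ i)
    (p : unitInterval) (hp0 : 0 < p) (hp1 : p < 1) :
    ({c ∈ Sandpile.SSMRec (Sandpile.wheel (2 * n)) μ p |
        Sandpile.level (Sandpile.wheel (2 * n)) c = n ∧ Sandpile.weight01 c = n - k}.ncard =
          (2 * k).choose k * (n + k - 1).choose (n - k) ∧
      {c ∈ Sandpile.ASMRec (Sandpile.wheel (2 * n)) μ |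
        Sandpile.level (Sandpile.wheel (2 * n)) c = n ∧ Sandpile.weight01 c = n - k}.ncard =
          (2 * k).choose k * (n + k - 1).choose (n - k)) ∧
    ({H ∈ Sandpile.Sub (Sandpile.cycle (2 * n)) |
        H.edgeSet.ncard = n ∧ Sandpile.numComponents H = k}.ncard =
          (2 * k).choose k * (n + k - 1).choose (n - k) ∧
      ∀ H ∈ Sandpile.Sub (Sandpile.cycle (2 * n)), H.edgeSet.ncard = n →
        (Sandpile.numComponents H = k ↔ H.vertexSet.ncard = n + k)) ∧
    ({w ∈ Sandpile.DiffDel n | w.count Sandpile.Step.R = k}.ncard =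
          (2 * k).choose k * (n + k - 1).choose (n - k) ∧
      ∀ w ∈ Sandpile.DiffDel n,
        (w.count Sandpile.Step.R = k ↔ w.count Sandpile.Step.D = n - k)) := by
  have hm : 2 ≤ 2 * n := by omega
  have hlevel : ∀ c : Sandpile.Config (Fin (2 * n)),
      Sandpile.level (Sandpile.wheel (2 * n)) c = n ↔ ∑ i, c i = 2 * n + n := by
    intro c
    rw [Sandpile.level_wheel, ← Nat.cast_sum]
    omega
  -- Level `n` means `3n` grains, more than `2n`, which is where recurrence equals edge-boundedness.
  have hconfigs : ∀ S : Set (Sandpile.Config (Fin (2 * n))),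
      (∀ c : Sandpile.Config (Fin (2 * n)), 2 * n < ∑ i, c i →
        (c ∈ S ↔ c ∈ Sandpile.Stable (Sandpile.wheel (2 * n)) ∧ Sandpile.EdgeBounded c)) →
      {c ∈ S | Sandpile.level (Sandpile.wheel (2 * n)) c = n ∧
        Sandpile.weight01 c = n - k}.ncard =
          (2 * k).choose k * (n + k - 1).choose (n - k) := by
    intro S hS
    rw [← Sandpile.ncard_subPairs hk hkn, ← Sandpile.ncard_configs_eq hm hn (by omega)]
    congr 1
    ext c
    simp only [Set.mem_ofPred_eq]
    rw [hlevel, show 2 * n - (n + k) = n - k by omega]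
    exact and_congr_left fun h => hS c (by omega)
  have hcomp : ∀ H ∈ Sandpile.Sub (Sandpile.cycle (2 * n)), H.edgeSet.ncard = n →
      (Sandpile.numComponents H = k ↔ H.vertexSet.ncard = n + k) := by
    intro H hH hE
    -- Having `n < 2n` edges, the subgraph is not the full cycle.
    have := Sandpile.numComponents_add_ncard hH.1 fun h => by
      rw [h, Set.ncard_univ, Nat.card_eq_fintype_card, Fintype.card_fin] at hE
      omega
    omega
  refine ⟨⟨hconfigs _ fun c hc => Sandpile.mem_SSMRec_iff hm hμ hp0 hp1 hc,
    hconfigs _ fun c hc => Sandpile.mem_ASMRec_iff hm hμ hc⟩, ⟨?_, hcomp⟩,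
    Sandpile.ncard_diffDel hk hkn, fun w hw => ?_⟩
  · rw [← Sandpile.ncard_subPairs hk hkn, ← Sandpile.ncard_subgraphs_eq hn]
    congr 1
    ext H
    exact and_congr_right fun hH => and_congr_right fun hE => hcomp H hH hE
  · obtain ⟨⟨h1, -⟩, -⟩ := Sandpile.mem_diffDel_iff.1 hw
    omega
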